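/- Let $m \ge 2$ and let $Q = \{[z] \in \mathbb{CP}^{m+1} : \sum_k z_k^2 = 0\}$ be the complex quadric, where $\mathbb{CP}^{m+1}$ carries the Fubini–Study metric that makes the Hopf fibration $S^{2m+3} \to \mathbb{CP}^{m+1}$ a Hermitian submersion. Fix $p = [z] \in Q$ with $\|z\| = 1$, let $W = \mathbb{C}z \oplus \mathbb{C}\bar z \subset \mathbb{C}^{m+2}$, and identify $T_pQ$ with its horizontal lift $W^\perp$. Let $J$ be the complex structure $v \mapsto iv$ of $T_pQ$, let $\langle v,w\rangle_{\mathbb{C}} = \langle v,w\rangle + i\langle v,Jw\rangle$ be its complex inner product, and let $\mathfrak{A} = \{A_\eta\}$ be the set of the shape operators of $Q \subset \mathbb{CP}^{m+1}$ at $p$ with respect to the unit normal vectors $\eta$ at $p$ (the $\mathbb{C}\mathrm{Q}$-structure of $T_pQ$). A $\mathbb{C}\mathrm{Q}$-automorphism is a unitary map $B : T_pQ \to T_pQ$ with $BAB^{-1} \in \mathfrak{A}$ for all $A \in \mathfrak{A}$. Let $G = \mathrm{SO}(m+2)$ act on $Q$, let $K$ be the isotropy group of $p$, let $\mathfrak{g}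 = \mathfrak{o}(m+2)$ and $\mathfrak{m} = \{X \in \mathfrak{g} : X(W) \subset W^\perp,\ X(W^\perp) \subset W\}$, and identify $\mathfrak{m}$ with $T_pQ$ via $X \mapsto \frac{d}{dt}\big|_{t=0} \exp(tX)p$, i.e. $X \mapsto Xz$. A Cartan subalgebra of $\mathfrak{m}$ is a real linear subspace $\mathfrak{a} \subset \mathfrak{m}$ with $[\mathfrak{a},\mathfrak{a}] = 0$ of maximal dimension among such subspaces. Characteristic angle: for $v \in \mathfrak{m}\setminus\{0\}$ choose a Cartan subalgebra $\mathfrak{a} = \mathbb{R}X \oplus \mathbb{R}JY$ containing $v$, where $A \in \mathfrak{A}$ and $X, Y$ are orthonormal vectors with $AX = X$, $AY = Y$, and $g \in K$ such that $\mathrm{Ad}(g)v$ lies in the closed cone $\{s\lambda_2^\sharp + t\lambda_4^\sharp : s,t \ge 0\}$ spanned by $\lambda_2^\sharp = \sqrt2\,X$ and $\lambda_4^\sharp = \sqrt2\,(X + JY)$; then $\varphi(v)$ is the angle between $\lambda_2^\sharp$ and $\mathrm{Ad}(g)v$. Let $v \in \mathfrak{m}\setminus\{0\}$. Such choices exist,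 $\varphi(v)$ does not depend on them (in particular not on the Cartan subalgebra), $\varphi(v) \in [0,\frac{\pi}{4}]$, and the following holds. (a) The number $|\langle v, Av\rangle_{\mathbb{C}}|$ does not depend on the choice of $A \in \mathfrak{A}$, and $\varphi(v)$ is the unique number in $[0,\frac{\pi}{4}]$ with $|\langle v, Av\rangle_{\mathbb{C}}| = \cos(2\varphi(v))\,\|v\|^2$. (b) $\varphi(cv) = \varphi(v)$ for every $c \in \mathbb{R}\setminus\{0\}$. (c) $\varphi(Bv) = \varphi(v)$ for every $\mathbb{C}\mathrm{Q}$-automorphism $B$ of $\mathfrak{m}$, and $\varphi(\mathrm{Ad}(g)v) = \varphi(v)$ for every $g \in K$; the latter even holds for every $g \in G$ with $g(W) = W$. (d) If $\mathfrak{a}$ is a Cartan subalgebra of $\mathfrak{m}$ with $v \in \mathfrak{a}$, and $v' \in \mathfrak{a}\setminus\{0\}$ satisfies $\langle v, v'\rangle = 0$, then $\varphi(v') = \varphi(v)$. -/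

import Mathlib

open Complex Real

namespace ComplexQuadric

noncomputable section

/-! ### The complex quadric, seen on the unit sphere of `ℂ^(m+2)` through the Hopf fibration -/

/-- The unitary space `ℂ^(m+2)`. -/
abbrev E (m : ℕ) : Type := EuclideanSpace ℂ (Fin (m + 2))

/-- The usual conjugation `z ↦ z̄` of `ℂ^(m+2)`. -/
def conjVec {m : ℕ} (w : E m) : E m :=
  WithLp.toLp 2 fun k => (starRingEnd ℂ) (w k)

/-- The preimage under the Hopf fibration `S^(2m+3) → ℂP^(m+1)` of the complex quadric
`Q^m = {[z] | ∑ z_k ^ 2 = 0}`. Its points `z` represent the points `p = [z]` of `Q^m`. -/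
def liftedQuadric (m : ℕ) : Set (E m) :=
  {z | ‖z‖ = 1 ∧ ∑ k, (z k) ^ 2 = 0}

/-- The complex plane `W` spanned by `z` and `z̄`. -/
def planeW {m : ℕ} (z : E m) : Submodule ℂ (E m) :=
  Submodule.span ℂ {z, conjVec z}

/-- The tangent space `T_p Q` at `p = [z]`, realized as its horizontal lift `(ℂ z ⊕ ℂ z̄)^⊥` at `z`.
Since the Hopf fibration is a Hermitian submersion, this is `T_p Q` as a unitary space, with the
complex structure `J v = i • v` and the restriction of the inner product of `ℂ^(m+2)`. -/
abbrev tangent {m : ℕ} (z : E m) : Submodule ℂ (E m) :=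
  (planeW z)ᗮ

/-- The normal space of `Q ⊆ ℂP^(m+1)` at `[z]`, realized as its horizontal lift at `z`: the
orthogonal complement of the horizontal lift of `T_p Q` in the horizontal space `(ℂ z)^⊥`. -/
def normalSpace {m : ℕ} (z : E m) : Submodule ℂ (E m) :=
  (Submodule.span ℂ {z})ᗮ ⊓ (tangent z)ᗮ

/-- The complex inner product `⟨v, w⟩_ℂ = ⟨v, w⟩ + i ⟨v, J w⟩` (complex linear in `v`; Mathlib's
`inner` is complex linear in its second argument). -/
def innerC {m : ℕ} {z : E m} (v w : tangent z) : ℂ := inner ℂ w v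

/-- The real inner product (the Riemannian metric) `⟨v, w⟩ = Re ⟨v, w⟩_ℂ`. -/
def innerR {m : ℕ} {z : E m} (v w : tangent z) : ℝ := (innerC v w).re

/-- The angle in `[0, π]` between two tangent vectors with respect to the Riemannian metric. -/
def angleR {m : ℕ} {z : E m} (v w : tangent z) : ℝ :=
  Real.arccos (innerR v w / (‖v‖ * ‖w‖))

/-- `S` is the shape operator `A_η` of `Q ⊆ ℂP^(m+1)` at `[z]` with respect to the normal vector `η`,
by the Weingarten formula: `A_η v` is minus the tangential part of the derivative of `N`, for
every curve `c` in (the lift of) `Q` through `z` with horizontal velocity `v` and every normal field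
`N` along `c` with `N(0) = η`. (By the submersion property, the derivative of a horizontal lift
along such a curve projects onto the covariant derivative in `ℂP^(m+1)`.) -/
def IsShapeOperator {m : ℕ} (z η : E m) (S : tangent z →ₗ[ℝ] tangent z) : Prop :=
  ∀ (c N : ℝ → E m) (v : tangent z) (n : E m),
    (∀ t, c t ∈ liftedQuadric m) → (∀ t, N t ∈ normalSpace (c t)) →
    c 0 = z → N 0 = η → HasDerivAt c (v : E m) 0 → HasDerivAt N n 0 →
    S v = -((tangent z).orthogonalProjectionOnto n)

/-- The circle of conjugations `𝔄(Q, p) = {A_η | η a unit normal vector at p}`, which is the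
`ℂQ`-structure of `T_p Q`. -/
def cqStructure {m : ℕ} (z : E m) : Set (tangent z →ₗ[ℝ] tangent z) :=
  {A | ∃ η ∈ normalSpace z, ‖η‖ = 1 ∧ IsShapeOperator z η A}

/-- `B` is a `ℂQ`-automorphism of `T_p Q`: a unitary map with `B ∘ A ∘ B⁻¹ ∈ 𝔄` for all `A ∈ 𝔄`. -/
def IsCQAutomorphism {m : ℕ} {z : E m} (B : tangent z ≃ₗᵢ[ℂ] tangent z) : Prop :=
  ∀ A ∈ cqStructure z, ∃ A' ∈ cqStructure z, ∀ v, A' v = B (A (B.symm v))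

/-! ### The symmetric structure: `G = SO(m+2)`, `𝔤 = 𝔬(m+2)`, `K`, `𝔪` -/

/-- Real square matrices of size `m+2`. -/
abbrev Mat (m : ℕ) : Type := Matrix (Fin (m + 2)) (Fin (m + 2)) ℝ

/-- The complex linear action of a real matrix on `ℂ^(m+2)`. -/
def act {m : ℕ} (X : Mat m) : E m →ₗ[ℂ] E m :=
  Matrix.toEuclideanLin (X.map ((↑) : ℝ → ℂ))

/-- The isotropy group `K` of the action of `G = SO(m+2)` on `Q` at `p = [z]`: the `g ∈ G` that
map the complex line `p` to itself. -/
def isotropyGroup {m : ℕ} (z : E m) : Set (Mat m) :=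
  {g | g ∈ Matrix.specialOrthogonalGroup (Fin (m + 2)) ℝ ∧
    (Submodule.span ℂ {z}).map (act g) = Submodule.span ℂ {z}}

/-- The group of all `g ∈ SO(m+2)` with `g(W) = W`. It contains the isotropy group. -/
def planeStabilizer {m : ℕ} (z : E m) : Set (Mat m) :=
  {g | g ∈ Matrix.specialOrthogonalGroup (Fin (m + 2)) ℝ ∧ (planeW z).map (act g) = planeW z}

theorem act_apply {m : ℕ} (X : Mat m) (w : E m) (i : Fin (m + 2)) :
    act X w i = ∑ j, (X i j : ℂ) * w j := by
  simp [act, Matrix.toLpLin_apply, Matrix.mulVec, dotProduct]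

theorem act_add {m : ℕ} (X Y : Mat m) : act (X + Y) = act X + act Y := by
  ext w i
  simp [act_apply, add_mul, Finset.sum_add_distrib]

theorem act_smul {m : ℕ} (r : ℝ) (X : Mat m) (w : E m) : act (r • X) w = r • act X w := by
  ext i
  simp [act_apply, Finset.mul_sum, mul_assoc]

theorem act_zero {m : ℕ} : act (0 : Mat m) = 0 := by
  ext w i
  simp [act_apply]

theorem act_one {m : ℕ} (w : E m) : act (1 : Mat m) w = w := by
  ext i
  simp [act_apply, Matrix.one_apply, apply_ite ((↑) : ℝ → ℂ), ite_mul]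

theorem act_mul {m : ℕ} (X Y : Mat m) (w : E m) : act (X * Y) w = act X (act Y w) := by
  have : (X * Y).map ((↑) : ℝ → ℂ) = X.map (↑) * Y.map (↑) := Matrix.map_mul (f := Complex.ofRealHom)
  simp [act, Matrix.toLpLin_apply, this]

theorem act_conjVec {m : ℕ} (X : Mat m) (w : E m) : act X (conjVec w) = conjVec (act X w) := by
  ext i
  simp [act_apply, conjVec]

theorem inner_act {m : ℕ} (X : Mat m) (u w : E m) :
    inner ℂ (act X u) w = inner ℂ u (act X.transpose w) := by
  simp only [PiLp.inner_apply, act_apply, RCLike.inner_apply, map_sum, map_mul, Complex.conj_ofReal,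
    Finset.mul_sum, Finset.sum_mul, Matrix.transpose_apply]
  rw [Finset.sum_comm]
  refine Finset.sum_congr rfl fun i _ => Finset.sum_congr rfl fun j _ => ?_
  ring

theorem conjVec_smul {m : ℕ} (a : ℂ) (w : E m) :
    conjVec (a • w) = (starRingEnd ℂ) a • conjVec w := by
  ext i
  simp [conjVec]

theorem conjVec_conjVec {m : ℕ} (w : E m) : conjVec (conjVec w) = w := by
  ext i
  simp [conjVec]

theorem mem_tangent {m : ℕ} {z w : E m} :
    w ∈ tangent z ↔ inner ℂ z w = 0 ∧ inner ℂ (conjVec z) w = 0 := by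
  rw [tangent, planeW, Submodule.mem_orthogonal]
  constructor
  · intro h
    exact ⟨h _ (Submodule.subset_span (by simp)), h _ (Submodule.subset_span (by simp))⟩
  · rintro ⟨h1, h2⟩ u hu
    obtain ⟨a, b, rfl⟩ := Submodule.mem_span_pair.1 hu
    simp [inner_add_left, inner_smul_left, h1, h2]

/-- The space `𝔪 = {X ∈ 𝔤 | X(W) ⊆ W^⊥, X(W^⊥) ⊆ W}` of the canonical decomposition
`𝔤 = 𝔨 ⊕ 𝔪` of `𝔤 = 𝔬(m+2)`. -/
def liem {m : ℕ} (z : E m) : Submodule ℝ (Mat m) where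
  carrier := {X | X.transpose = -X ∧
    (∀ w ∈ planeW z, act X w ∈ (planeW z)ᗮ) ∧ (∀ w ∈ (planeW z)ᗮ, act X w ∈ planeW z)}
  add_mem' := by
    rintro X Y ⟨hX, hX1, hX2⟩ ⟨hY, hY1, hY2⟩
    refine ⟨by rw [Matrix.transpose_add, hX, hY, neg_add], fun w hw => ?_, fun w hw => ?_⟩
    · rw [act_add]; exact add_mem (hX1 w hw) (hY1 w hw)
    · rw [act_add]; exact add_mem (hX2 w hw) (hY2 w hw)
  zero_mem' := by
    refine ⟨by simp, fun w hw => ?_, fun w hw => ?_⟩ <;> simp [act_zero]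
  smul_mem' := by
    rintro r X ⟨hX, hX1, hX2⟩
    refine ⟨by rw [Matrix.transpose_smul, hX, smul_neg], fun w hw => ?_, fun w hw => ?_⟩
    · rw [act_smul]; exact Submodule.smul_of_tower_mem _ r (hX1 w hw)
    · rw [act_smul]; exact Submodule.smul_of_tower_mem _ r (hX2 w hw)

theorem mem_liem {m : ℕ} {z : E m} {X : Mat m} : X ∈ liem z ↔ X.transpose = -X ∧
    (∀ w ∈ planeW z, act X w ∈ (planeW z)ᗮ) ∧ (∀ w ∈ (planeW z)ᗮ, act X w ∈ planeW z) :=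
  Iff.rfl

theorem self_mem_planeW {m : ℕ} (z : E m) : z ∈ planeW z :=
  Submodule.subset_span (by simp)

theorem conjVec_mem_planeW {m : ℕ} (z : E m) : conjVec z ∈ planeW z :=
  Submodule.subset_span (by simp)

theorem act_mem {m : ℕ} (z : E m) (X : liem z) : act (X : Mat m) z ∈ tangent z :=
  (mem_liem.1 X.2).2.1 z (self_mem_planeW z)

/-- The map `X ↦ X z`, which describes `τ : 𝔪 → T_p Q`, `X ↦ d/dt exp(t X) p` at `t = 0`, in terms of
horizontal lifts. -/
def tauLin {m : ℕ} (z : E m) : liem z →ₗ[ℝ] tangent z where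
  toFun X := ⟨act (X : Mat m) z, act_mem z X⟩
  map_add' X Y := Subtype.ext (LinearMap.congr_fun (act_add (X : Mat m) (Y : Mat m)) z)
  map_smul' r X := Subtype.ext (act_smul r (X : Mat m) z)

theorem tauLin_injective {m : ℕ} (z : E m) : Function.Injective (tauLin z) := by
  rw [injective_iff_map_eq_zero]
  rintro ⟨X, hXm⟩ h
  obtain ⟨hX, hX1, hX2⟩ := mem_liem.1 hXm
  have h0 : act X z = 0 := congrArg Subtype.val h
  have h1 : act X (conjVec z) = 0 := by
    rw [act_conjVec, h0]; ext i; simp [conjVec]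
  have hW : ∀ w ∈ planeW z, act X w = 0 := by
    intro w hw
    obtain ⟨a, b, rfl⟩ := Submodule.mem_span_pair.1 hw
    simp [h0, h1]
  have hT : X.transpose = -X := hX
  have hall : ∀ w, act X w = 0 := by
    intro w
    obtain ⟨a, ha, b, hb, rfl⟩ := (planeW z).exists_add_mem_mem_orthogonal w
    rw [map_add, hW a ha, zero_add]
    have hb2 := hX2 b hb
    have h3 : inner ℂ (act X b) (act X b) = (0 : ℂ) := by
      rw [inner_act, hT, show (-X) = (-1 : ℝ) • X by simp, act_smul, hW _ hb2]
      simp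
    exact inner_self_eq_zero.1 h3
  have : X = 0 := by
    ext i j
    have := congrArg (fun u : E m => u i) (hall (EuclideanSpace.single j 1))
    simpa [act_apply] using this
  exact Subtype.ext this

/-- The inverse of `τ`: the real skew-symmetric matrix `u z^* - z u^* + ū z̄^* - z̄ ū^*`. -/
def tauInvMat {m : ℕ} (z u : E m) : Mat m :=
  Matrix.of fun i j => 2 * (u i * (starRingEnd ℂ) (z j) - z i * (starRingEnd ℂ) (u j)).re

theorem act_tauInvMat {m : ℕ} (z u w : E m) :
    act (tauInvMat z u) w = inner ℂ z w • u - inner ℂ u w • z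
      + inner ℂ (conjVec z) w • conjVec u - inner ℂ (conjVec u) w • conjVec z := by
  ext i
  have key : ∀ a : ℂ, ((2 * a.re : ℝ) : ℂ) = a + (starRingEnd ℂ) a := by
    intro a; rw [Complex.add_conj]
  simp only [act_apply, tauInvMat, Matrix.of_apply, key, PiLp.add_apply, PiLp.sub_apply,
    PiLp.smul_apply, PiLp.inner_apply, RCLike.inner_apply, conjVec, smul_eq_mul, Finset.sum_mul,
    map_sub, map_mul, Complex.conj_conj]
  rw [← Finset.sum_sub_distrib, ← Finset.sum_add_distrib, ← Finset.sum_sub_distrib]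
  refine Finset.sum_congr rfl fun j _ => ?_
  ring

theorem inner_conjVec_self {m : ℕ} {z : E m} (hz : z ∈ liftedQuadric m) :
    inner ℂ (conjVec z) z = 0 := by
  simpa [PiLp.inner_apply, conjVec, pow_two] using hz.2

theorem inner_conjVec_conjVec {m : ℕ} (u w : E m) :
    inner ℂ (conjVec u) (conjVec w) = inner ℂ w u := by
  simp [PiLp.inner_apply, conjVec, mul_comm]

theorem conjVec_mem_tangent {m : ℕ} {z u : E m} (hu : u ∈ tangent z) : conjVec u ∈ tangent z := by
  rw [mem_tangent] at hu ⊢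
  refine ⟨?_, ?_⟩
  · have := inner_conjVec_conjVec (conjVec z) u
    rw [conjVec_conjVec] at this
    rw [this, inner_eq_zero_symm]; exact hu.2
  · rw [inner_conjVec_conjVec, inner_eq_zero_symm]; exact hu.1

theorem tauLin_surjective {m : ℕ} (z : liftedQuadric m) :
    Function.Surjective (tauLin (z : E m)) := by
  obtain ⟨z, hz⟩ := z
  rintro ⟨u, hu⟩
  have hu' := mem_tangent.1 hu
  have hv' := mem_tangent.1 (conjVec_mem_tangent hu)
  have hzz : inner ℂ z z = (1 : ℂ) := by
    rw [inner_self_eq_norm_sq_to_K, hz.1]; simp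
  have hcz := inner_conjVec_self hz
  have hzc : inner ℂ z (conjVec z) = (0 : ℂ) := inner_eq_zero_symm.1 hcz
  have hcc : inner ℂ (conjVec z) (conjVec z) = (1 : ℂ) := by rw [inner_conjVec_conjVec, hzz]
  have e1 : act (tauInvMat z u) z = u := by
    rw [act_tauInvMat, hzz, hcz, inner_eq_zero_symm.1 hu'.1, inner_eq_zero_symm.1 hv'.1]
    simp
  have e2 : act (tauInvMat z u) (conjVec z) = conjVec u := by rw [act_conjVec, e1]
  refine ⟨⟨tauInvMat z u, mem_liem.2 ⟨?_, ?_, ?_⟩⟩, Subtype.ext e1⟩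
  · ext i j
    simp [tauInvMat]
    ring
  · intro w hw
    obtain ⟨a, b, rfl⟩ := Submodule.mem_span_pair.1 hw
    rw [map_add, map_smul, map_smul, e1, e2]
    exact add_mem (Submodule.smul_mem _ _ hu) (Submodule.smul_mem _ _ (conjVec_mem_tangent hu))
  · intro w hw
    have hw' := mem_tangent.1 hw
    rw [act_tauInvMat, hw'.1, hw'.2]
    simp only [zero_smul, zero_sub, add_zero]
    exact sub_mem (neg_mem (Submodule.smul_mem _ _ (self_mem_planeW z)))
      (Submodule.smul_mem _ _ (conjVec_mem_planeW z))

/-- The canonical isomorphism `τ : 𝔪 → T_p Q`, by which `𝔪` and `T_p Q` are identified. -/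
def tau {m : ℕ} (z : liftedQuadric m) : liem (z : E m) ≃ₗ[ℝ] tangent (z : E m) :=
  LinearEquiv.ofBijective (tauLin (z : E m)) ⟨tauLin_injective _, tauLin_surjective z⟩

theorem isotropyGroup_subset {m : ℕ} (z : E m) : isotropyGroup z ⊆ planeStabilizer z := by
  rintro g ⟨hg, h⟩
  refine ⟨hg, ?_⟩
  have hz : act g z ∈ Submodule.span ℂ {z} := by
    rw [← h]; exact Submodule.mem_map_of_mem (Submodule.mem_span_singleton_self z)
  obtain ⟨a, ha⟩ := Submodule.mem_span_singleton.1 hz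
  obtain ⟨y, hy, hyz⟩ : z ∈ (Submodule.span ℂ {z}).map (act g) := by
    rw [h]; exact Submodule.mem_span_singleton_self z
  obtain ⟨b, rfl⟩ := Submodule.mem_span_singleton.1 hy
  apply le_antisymm
  · rw [planeW, Submodule.map_span_le]
    intro w hw
    rcases hw with rfl | rfl
    · rw [← ha]; exact Submodule.smul_mem _ _ (self_mem_planeW _)
    · rw [act_conjVec, ← ha, conjVec_smul]; exact Submodule.smul_mem _ _ (conjVec_mem_planeW _)
  · rw [planeW, Submodule.span_le]
    intro w hw
    rcases hw with rfl | rfl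
    · exact ⟨_, Submodule.smul_mem _ b (self_mem_planeW _), hyz⟩
    · refine ⟨conjVec (b • z), ?_, ?_⟩
      · rw [conjVec_smul]; exact Submodule.smul_mem _ _ (conjVec_mem_planeW _)
      · rw [act_conjVec, hyz]

theorem orth_of_mem {m : ℕ} {g : Mat m}
    (hg : g ∈ Matrix.specialOrthogonalGroup (Fin (m + 2)) ℝ) :
    g.transpose * g = 1 ∧ g * g.transpose = 1 := by
  have h := (Matrix.mem_specialOrthogonalGroup_iff.1 hg).1
  exact ⟨(Matrix.mem_orthogonalGroup_iff' _ _).1 h, (Matrix.mem_orthogonalGroup_iff _ _).1 h⟩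

/-- `Ad(g) X = g X g⁻¹` maps `𝔪` into `𝔪` if `g(W) = W`. -/
theorem Ad_mem {m : ℕ} {z : E m} {g : Mat m} (hg : g ∈ planeStabilizer z) {X : Mat m}
    (hX : X ∈ liem z) : g * X * g.transpose ∈ liem z := by
  obtain ⟨hg, hW⟩ := hg
  obtain ⟨hX, hX1, hX2⟩ := mem_liem.1 hX
  obtain ⟨o1, o2⟩ := orth_of_mem hg
  have f1 : ∀ w ∈ planeW z, act g w ∈ planeW z := fun w hw => by
    rw [← hW]; exact Submodule.mem_map_of_mem hw
  have f2 : ∀ w ∈ planeW z, act g.transpose w ∈ planeW z := fun w hw => by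
    rw [← hW] at hw
    obtain ⟨y, hy, rfl⟩ := hw
    rw [← act_mul, o1, act_one]; exact hy
  have f3 : ∀ w ∈ (planeW z)ᗮ, act g w ∈ (planeW z)ᗮ := fun w hw => by
    rw [Submodule.mem_orthogonal] at hw ⊢
    intro u hu
    rw [← Matrix.transpose_transpose g, ← inner_act]
    exact hw _ (f2 u hu)
  have f4 : ∀ w ∈ (planeW z)ᗮ, act g.transpose w ∈ (planeW z)ᗮ := fun w hw => by
    rw [Submodule.mem_orthogonal] at hw ⊢
    intro u hu
    rw [← inner_act]
    exact hw _ (f1 u hu)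
  refine mem_liem.2 ⟨?_, fun w hw => ?_, fun w hw => ?_⟩
  · simp [Matrix.transpose_mul, hX, Matrix.mul_assoc]
  · rw [act_mul, act_mul]; exact f3 _ (hX1 _ (f2 w hw))
  · rw [act_mul, act_mul]; exact f1 _ (hX2 _ (f4 w hw))

/-- The map `Ad(g) : 𝔪 → 𝔪`, `X ↦ g X g⁻¹` (with `g⁻¹ = gᵀ`), for `g ∈ SO(m+2)` with `g(W) = W`, in
particular for `g ∈ K`; it is written on `T_p Q` by means of `τ`. -/
def Ad {m : ℕ} (z : liftedQuadric m) (g : Mat m) (hg : g ∈ planeStabilizer (z : E m))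
    (v : tangent (z : E m)) : tangent (z : E m) :=
  tau z ⟨g * ((tau z).symm v : Mat m) * g.transpose, Ad_mem hg ((tau z).symm v).2⟩

/-- A real subspace `𝔞` of `𝔪 ≅ T_p Q` is flat if `[𝔞, 𝔞] = 0`, the bracket being the one of
`𝔤 = 𝔬(m+2)`. -/
def IsFlat {m : ℕ} (z : liftedQuadric m) (a : Submodule ℝ (tangent (z : E m))) : Prop :=
  ∀ u ∈ a, ∀ v ∈ a, ⁅((tau z).symm u : Mat m), ((tau z).symm v : Mat m)⁆ = 0

/-- The Cartan subalgebras of `𝔪` are the flat subspaces of maximal dimension. -/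
def IsCartan {m : ℕ} (z : liftedQuadric m) (a : Submodule ℝ (tangent (z : E m))) : Prop :=
  IsFlat z a ∧ ∀ b : Submodule ℝ (tangent (z : E m)), IsFlat z b →
    Module.finrank ℝ b ≤ Module.finrank ℝ a

/-- `ψ` arises as a characteristic angle of `v`: there are a Cartan subalgebra
`𝔞 = ℝ X ⊕ ℝ J Y` containing `v`, with `A ∈ 𝔄` and `X, Y` orthonormal vectors in `V(A) = Eig(A, 1)`,
and some `g ∈ K` such that `Ad(g) v` lies in the closed cone of `𝔞` bounded by the root vectors
`λ₂♯ = √2 X` and `λ₄♯ = √2 (X + J Y)`, and `ψ` is the angle between `λ₂♯` and `Ad(g) v`. -/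
def IsCharacteristicAngle {m : ℕ} (z : liftedQuadric m) (v : tangent (z : E m)) (ψ : ℝ) : Prop :=
  ∃ a : Submodule ℝ (tangent (z : E m)), IsCartan z a ∧ v ∈ a ∧
    ∃ A ∈ cqStructure (z : E m), ∃ X Y : tangent (z : E m),
      A X = X ∧ A Y = Y ∧ ‖X‖ = 1 ∧ ‖Y‖ = 1 ∧ innerR X Y = 0 ∧
      a = Submodule.span ℝ {X, I • Y} ∧
      ∃ (g : Mat m) (hg : g ∈ isotropyGroup (z : E m)),
        (∃ s t : ℝ, 0 ≤ s ∧ 0 ≤ t ∧ Ad z g (isotropyGroup_subset _ hg) v =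
          s • (√2 • X) + t • (√2 • (X + I • Y))) ∧
        ψ = angleR (√2 • X) (Ad z g (isotropyGroup_subset _ hg) v)

open Classical in
/-- The characteristic angle `φ(v)` (with the value `0` if there is none). -/
def charAngle {m : ℕ} (z : liftedQuadric m) (v : tangent (z : E m)) : ℝ :=
  if h : ∃ ψ, IsCharacteristicAngle z v ψ then h.choose else 0

end

end ComplexQuadric

open ComplexQuadric

namespace ComplexQuadric

/-! The shape operators at `[z]` are exactly the maps `v ↦ μ v̄` with `|μ| = 1` (`mem_cqStructure`).
Hence `|⟨v, A v⟩|` is the modulus of `∑ v_k ^ 2`, called `quadNorm v` below, for every `A` of the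
circle. The whole theorem says that the angle records the ratio of `quadNorm v` to `‖v‖ ^ 2`.

If `w = α X + β J Y` with `X, Y` orthonormal and fixed by `A`, then `quadNorm w = |α² - β²|` and
`‖w‖² = α² + β²`. The cone is `0 ≤ β ≤ α`, where the angle `ψ` to `X` lies in `[0, π/4]` and
satisfies `cos (2ψ) ‖w‖² = α² - β²`. Since `Ad g` preserves both norm and `quadNorm`, and `cos (2ψ)`
is injective on `[0, π/4]`, the angle is determined by `v` (`IsCharacteristicAngle.mem_Icc_and_eq`).
This gives uniqueness, (a), and, by invariance or scaling of the two quantities, (b) and (c).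

For existence, `μ` is chosen so that `⟨A v, v⟩` is real and nonnegative. Then the parts `P, R` in `v
= P + J R` with `A P = P`, `A R = R` are orthogonal and `‖R‖ ≤ ‖P‖`, so `v` already lies in the
cone. That the plane obtained is a Cartan subalgebra requires that flat subspaces have real
dimension at most two (`IsFlat.finrank_le_two`). This bound and (d) both come from the explicit form
of `[u, v] = 0` in `lie_eq_zero_iff`. -/

theorem conjVec_add {m : ℕ} (u w : E m) : conjVec (u + w) = conjVec u + conjVec w := by
  ext i
  simp [conjVec]

theorem conjVec_sub {m : ℕ} (u w : E m) : conjVec (u - w) = conjVec u - conjVec w := by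
  ext i
  simp [conjVec]

theorem inner_conjVec_left {m : ℕ} (u w : E m) :
    inner ℂ (conjVec u) w = ∑ k, u k * w k := by
  simp [PiLp.inner_apply, conjVec, mul_comm]

theorem inner_conjVec_comm {m : ℕ} (u w : E m) :
    inner ℂ (conjVec u) w = inner ℂ (conjVec w) u := by
  simp [inner_conjVec_left, mul_comm]

theorem norm_conjVec {m : ℕ} (w : E m) : ‖conjVec w‖ = ‖w‖ := by
  simp [EuclideanSpace.norm_eq, conjVec]

/-- Conjugation as a real linear isometry. -/
noncomputable def conjIsometry (m : ℕ) : E m →ₗᵢ[ℝ] E m where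
  toFun := conjVec
  map_add' := conjVec_add
  map_smul' r w := by
    ext i
    simp [conjVec]
  norm_map' := norm_conjVec

theorem hasDerivAt_conjVec {m : ℕ} {c : ℝ → E m} {v : E m} {t : ℝ} (h : HasDerivAt c v t) :
    HasDerivAt (fun s => conjVec (c s)) (conjVec v) t :=
  (conjIsometry m).toContinuousLinearMap.hasFDerivAt.comp_hasDerivAt t h

/-! ### Normal spaces, curves in the quadric, and the circle of shape operators. -/

section Lifted

variable {m : ℕ} {z : E m}

theorem inner_self_lifted (hz : z ∈ liftedQuadric m) : inner ℂ z z = (1 : ℂ) := by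
  rw [inner_self_eq_norm_sq_to_K, hz.1]; simp

theorem inner_self_conjVec (hz : z ∈ liftedQuadric m) : inner ℂ z (conjVec z) = (0 : ℂ) :=
  inner_eq_zero_symm.1 (inner_conjVec_self hz)

theorem inner_conjVec_conjVec_self (hz : z ∈ liftedQuadric m) :
    inner ℂ (conjVec z) (conjVec z) = (1 : ℂ) := by
  rw [inner_conjVec_conjVec, inner_self_lifted hz]

/-- The normal space is the complex line through `z̄`: of the plane `W`, only the part orthogonal to
`z` remains. -/
theorem mem_normalSpace (hz : z ∈ liftedQuadric m) {η : E m} :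
    η ∈ normalSpace z ↔ η = inner ℂ (conjVec z) η • conjVec z := by
  rw [normalSpace, Submodule.mem_inf, tangent, Submodule.orthogonal_orthogonal,
    Submodule.mem_orthogonal_singleton_iff_inner_right]
  constructor
  · rintro ⟨h, hη⟩
    obtain ⟨a, b, rfl⟩ := Submodule.mem_span_pair.1 hη
    simp only [inner_add_right, inner_smul_right, inner_self_lifted hz, inner_self_conjVec hz,
      inner_conjVec_self hz, inner_conjVec_conjVec_self hz, mul_one, mul_zero, add_zero,
      zero_add] at h ⊢
    simp [h]
  · intro h
    rw [h]
    refine ⟨by rw [inner_smul_right, inner_self_conjVec hz, mul_zero], ?_⟩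
    exact Submodule.smul_mem _ _ (conjVec_mem_planeW z)

/-- The conjugation `v ↦ μ v̄` of the tangent space. -/
noncomputable def tangentConj (z : E m) (μ : ℂ) : tangent z →ₗ[ℝ] tangent z where
  toFun v := ⟨μ • conjVec v, Submodule.smul_mem _ _ (conjVec_mem_tangent v.2)⟩
  map_add' u v := Subtype.ext (by simp [conjVec_add])
  map_smul' r v := Subtype.ext (by
    ext i
    simp [conjVec]
    ring)

@[simp]
theorem coe_tangentConj (z : E m) (μ : ℂ) (v : tangent z) :
    (tangentConj z μ v : E m) = μ • conjVec (v : E m) := rfl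

/-- A normal field along `c` has the form `N = f c̄` with `f = ⟨c̄, N⟩`. Its derivative at `0` is
`f(0) v̄ + f'(0) z̄`, and only the first term is tangential. -/
theorem isShapeOperator_tangentConj {η : E m} :
    IsShapeOperator z η (tangentConj z (-inner ℂ (conjVec z) η)) := by
  intro c N v n hc hN hc0 hN0 hcv hNn
  have e : N = fun t => (inner ℂ (conjVec (c t)) (N t) : ℂ) • conjVec (c t) :=
    funext fun t => (mem_normalSpace (hc t)).1 (hN t)
  have hd := hasDerivAt_conjVec hcv
  have h2 := (hd.inner ℂ hNn).smul hd
  have h3 := hNn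
  rw [e] at h3
  have h4 := h3.unique h2
  simp only [hc0, hN0] at h4
  have h5 : (tangent z).orthogonalProjectionOnto n
      = ⟨inner ℂ (conjVec z) η • conjVec v, Submodule.smul_mem _ _ (conjVec_mem_tangent v.2)⟩ := by
    have h6 : conjVec z ∈ (tangent z)ᗮ := by
      rw [tangent, Submodule.orthogonal_orthogonal]
      exact conjVec_mem_planeW z
    rw [h4, map_add, map_smul, map_smul,
      Submodule.orthogonalProjectionOnto_apply_of_mem_orthogonal h6, smul_zero, add_zero]
    exact congrArg _
      (Submodule.orthogonalProjectionOnto_mem_subspace_eq_self ⟨_, conjVec_mem_tangent v.2⟩)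
  rw [h5]
  refine Subtype.ext ?_
  simp

theorem norm_sq_curve (hz : z ∈ liftedQuadric m) (v : tangent z) (t : ℝ) (s : ℂ) :
    ‖z + t • (v : E m) + s • conjVec z‖ ^ 2 = 1 + t ^ 2 * ‖v‖ ^ 2 + ‖s‖ ^ 2 := by
  have hv := mem_tangent.1 v.2
  have h1 : inner ℂ (z + t • (v : E m)) (s • conjVec z) = 0 := by
    rw [inner_add_left, inner_smul_right, inner_self_conjVec hz, inner_smul_right,
      inner_smul_left_eq_smul, inner_eq_zero_symm.1 hv.2]
    simp
  have h2 : inner ℂ z (t • (v : E m)) = 0 := by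
    rw [inner_smul_right_eq_smul, hv.1, smul_zero]
  rw [sq, norm_add_sq_eq_norm_sq_add_norm_sq_of_inner_eq_zero _ _ h1,
    norm_add_sq_eq_norm_sq_add_norm_sq_of_inner_eq_zero _ _ h2, norm_smul, norm_smul,
    norm_conjVec, hz.1, Real.norm_eq_abs]
  rw [mul_mul_mul_comm, abs_mul_abs_self, Submodule.coe_norm]
  ring

/-- Every tangent vector is a velocity, so the Weingarten condition in `IsShapeOperator` is not
vacuous and determines the operator. -/
theorem exists_curve (hz : z ∈ liftedQuadric m) (v : tangent z) :
    ∃ c : ℝ → E m, (∀ t, c t ∈ liftedQuadric m) ∧ c 0 = z ∧ HasDerivAt c (v : E m) 0 := by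
  have hv := mem_tangent.1 v.2
  set q : ℂ := inner ℂ (conjVec (v : E m)) (v : E m) with hq
  -- With `Q(x) = ∑ x_k ^ 2`, the polarized form of `Q` pairs `z` and `z̄` to `1`, and `Q(z + t v) =
  -- t² q`. The `z̄`-coefficient `-t² q / 2` therefore makes `Q` vanish along `f`.
  let f : ℝ → E m := fun t => z + t • (v : E m) + (-((t : ℂ) ^ 2 * q / 2)) • conjVec z
  let ρ : ℝ → ℝ := fun t => 1 + t ^ 2 * ‖v‖ ^ 2 + t ^ 4 * (‖q‖ / 2) ^ 2
  have hρ : ∀ t, 0 < ρ t := fun t => by positivity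
  have hf : ∀ t, ‖f t‖ ^ 2 = ρ t := fun t => by
    rw [norm_sq_curve hz]
    simp only [ρ, norm_neg, norm_div, norm_mul, norm_pow, Complex.norm_real, Real.norm_eq_abs,
      sq_abs, Complex.norm_ofNat]
    ring
  refine ⟨fun t => (√(ρ t))⁻¹ • f t, fun t => ⟨?_, ?_⟩, ?_, ?_⟩
  · rw [norm_smul, ← hf t, Real.sqrt_sq (norm_nonneg _), norm_inv, norm_norm, inv_mul_cancel₀]
    intro h
    have := hf t
    rw [h] at this
    have := hρ t
    simp_all
  · have e : ∑ k, (f t k) ^ 2 = inner ℂ (conjVec (f t)) (f t) := by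
      rw [inner_conjVec_left]; simp [sq]
    have h0 : inner ℂ (conjVec (f t)) (f t) = 0 := by
      have hzv : inner ℂ (conjVec z) (v : E m) = 0 := hv.2
      have hvz : inner ℂ (conjVec (v : E m)) z = 0 := by rw [inner_conjVec_comm, hzv]
      have hvz' : inner ℂ (v : E m) z = 0 := inner_eq_zero_symm.1 hv.1
      have hcv : inner ℂ (conjVec (v : E m)) (conjVec z) = 0 := by
        rw [inner_conjVec_conjVec, hv.1]
      have ht : ∀ w : E m, t • w = (t : ℂ) • w := fun w => by
        ext i; simp
      simp only [f, ht, conjVec_add, conjVec_smul, conjVec_conjVec, inner_add_left, inner_add_right,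
        inner_smul_left, inner_smul_right, inner_self_lifted hz, inner_conjVec_self hz,
        inner_self_conjVec hz, inner_conjVec_conjVec_self hz, hzv, hvz, hv.1, hcv, ← hq]
      simp
      ring
    have : ∀ k, ((√(ρ t))⁻¹ • f t) k = ((√(ρ t))⁻¹ : ℂ) * f t k := fun k => by simp
    simp only [this, mul_pow, ← Finset.mul_sum, e, h0, mul_zero]
  · simp [ρ, f]
  · have hf' : HasDerivAt f (v : E m) 0 := by
      have h1 : HasDerivAt (fun t : ℝ => -((t : ℂ) ^ 2 * q / 2)) 0 0 := by
        exact (((((hasDerivAt_id (0 : ℝ)).ofReal_comp).pow 2).mul_const q).div_const 2).neg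
          |>.congr_deriv (by simp)
      exact (((hasDerivAt_id (0 : ℝ)).smul_const (v : E m)).const_add z).add
        (h1.smul_const (conjVec z)) |>.congr_deriv (by simp)
    -- The squared length of `f` is stationary at `0`, so normalizing does not alter the velocity.
    have hρ' : HasDerivAt ρ 0 0 := by
      have h2 := ((hasDerivAt_id (0 : ℝ)).pow 2).mul_const (‖v‖ ^ 2)
      have h4 := ((hasDerivAt_id (0 : ℝ)).pow 4).mul_const ((‖q‖ / 2) ^ 2)
      exact (h2.const_add 1).add h4 |>.congr_deriv (by simp)
    have hs := (hρ'.sqrt (hρ 0).ne').inv (by simp [ρ])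
    exact (hs.smul hf').congr_deriv (by simp [ρ])

theorem mem_cqStructure (hz : z ∈ liftedQuadric m) {A : tangent z →ₗ[ℝ] tangent z} :
    A ∈ cqStructure z ↔ ∃ μ : ℂ, ‖μ‖ = 1 ∧ A = tangentConj z μ := by
  constructor
  · rintro ⟨η, hη, hη1, hA⟩
    refine ⟨-inner ℂ (conjVec z) η, ?_, ?_⟩
    · have := congrArg norm ((mem_normalSpace hz).1 hη)
      rw [norm_smul, norm_conjVec, hz.1, mul_one, hη1] at this
      rw [norm_neg, ← this]
    · ext1 v
      obtain ⟨c, hc, hc0, hcv⟩ := exists_curve hz v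
      -- The normal vector `η = ⟨z̄, η⟩ z̄` is extended along `c` with a constant coefficient in
      -- front of `c̄`.
      have hN : ∀ t, (inner ℂ (conjVec z) η : ℂ) • conjVec (c t) ∈ normalSpace (c t) := fun t => by
        rw [mem_normalSpace (hc t), inner_smul_right, inner_conjVec_conjVec_self (hc t), mul_one]
      have hd := (hasDerivAt_conjVec hcv).const_smul (inner ℂ (conjVec z) η : ℂ)
      have h0 : (inner ℂ (conjVec z) η : ℂ) • conjVec (c 0) = η := by
        rw [hc0, ← (mem_normalSpace hz).1 hη]
      rw [hA c _ v _ hc hN hc0 h0 hcv hd,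
        isShapeOperator_tangentConj c _ v _ hc hN hc0 h0 hcv hd]
  · rintro ⟨μ, hμ, rfl⟩
    have e : inner ℂ (conjVec z) (-μ • conjVec z) = -μ := by
      rw [inner_smul_right, inner_conjVec_conjVec_self hz, mul_one]
    refine ⟨-μ • conjVec z, ?_, ?_, ?_⟩
    · rw [mem_normalSpace hz, e]
    · rw [norm_smul, norm_conjVec, hz.1, norm_neg, hμ, mul_one]
    · have := isShapeOperator_tangentConj (z := z) (η := -μ • conjVec z)
      rwa [e, neg_neg] at this

theorem tangentConj_mem_cqStructure (hz : z ∈ liftedQuadric m) {μ : ℂ} (hμ : ‖μ‖ = 1) :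
    tangentConj z μ ∈ cqStructure z :=
  (mem_cqStructure hz).2 ⟨μ, hμ, rfl⟩

end Lifted

/-! ### The bracket of two elements of `𝔪` as an operator on `ℂ^(m+2)`. -/

section Bracket

variable {m : ℕ} {z : E m}

theorem act_tauInvMat_self (hz : z ∈ liftedQuadric m) {u : E m} (hu : u ∈ tangent z) :
    act (tauInvMat z u) z = u := by
  rw [act_tauInvMat, inner_self_lifted hz, inner_conjVec_self hz,
    inner_eq_zero_symm.1 (mem_tangent.1 hu).1,
    inner_eq_zero_symm.1 (mem_tangent.1 (conjVec_mem_tangent hu)).1]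
  simp

theorem tauInvMat_mem_liem (hz : z ∈ liftedQuadric m) {u : E m} (hu : u ∈ tangent z) :
    tauInvMat z u ∈ liem z := by
  refine mem_liem.2 ⟨?_, fun w hw => ?_, fun w hw => ?_⟩
  · ext i j
    simp [tauInvMat]
    ring
  · obtain ⟨a, b, rfl⟩ := Submodule.mem_span_pair.1 hw
    rw [map_add, map_smul, map_smul, act_conjVec, act_tauInvMat_self hz hu]
    exact add_mem (Submodule.smul_mem _ _ hu) (Submodule.smul_mem _ _ (conjVec_mem_tangent hu))
  · rw [act_tauInvMat, (mem_tangent.1 hw).1, (mem_tangent.1 hw).2]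
    simp only [zero_smul, zero_sub, add_zero]
    exact sub_mem (neg_mem (Submodule.smul_mem _ _ (self_mem_planeW z)))
      (Submodule.smul_mem _ _ (conjVec_mem_planeW z))

theorem tau_symm_eq (z : liftedQuadric m) (u : tangent (z : E m)) :
    ((tau z).symm u : Mat m) = tauInvMat (z : E m) u := by
  have : (tau z).symm u = ⟨tauInvMat (z : E m) u, tauInvMat_mem_liem z.2 u.2⟩ := by
    rw [LinearEquiv.symm_apply_eq]
    exact Subtype.ext (act_tauInvMat_self z.2 u.2).symm
  rw [this]

theorem act_sub (X Y : Mat m) (w : E m) : act (X - Y) w = act X w - act Y w := by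
  ext i
  simp [act_apply, sub_mul]

theorem eq_zero_of_act_eq_zero {X : Mat m} (h : ∀ w, act X w = 0) : X = 0 := by
  ext i j
  have := congrArg (fun u : E m => u i) (h (EuclideanSpace.single j 1))
  simpa [act_apply] using this

theorem act_tauInvMat_tangent {u v : E m} (hv : v ∈ tangent z) :
    act (tauInvMat z u) v = -(inner ℂ u v : ℂ) • z - (inner ℂ (conjVec u) v : ℂ) • conjVec z := by
  rw [act_tauInvMat, (mem_tangent.1 hv).1, (mem_tangent.1 hv).2]
  simp

theorem act_mul_tauInvMat (hz : z ∈ liftedQuadric m) {u v : E m} (hu : u ∈ tangent z)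
    (hv : v ∈ tangent z) (w : E m) :
    act (tauInvMat z u * tauInvMat z v) w =
      -(inner ℂ z w * inner ℂ u v
        + inner ℂ (conjVec z) w * (starRingEnd ℂ) (inner ℂ (conjVec u) v) : ℂ) • z
      - (inner ℂ z w * inner ℂ (conjVec u) v + inner ℂ (conjVec z) w * inner ℂ v u : ℂ) • conjVec z
      - (inner ℂ v w : ℂ) • u - (inner ℂ (conjVec v) w : ℂ) • conjVec u := by
  rw [act_mul, act_tauInvMat z v w]
  simp only [map_add, map_sub, map_smul, act_conjVec, act_tauInvMat_self hz hu,
    act_tauInvMat_tangent hv, conjVec_sub, conjVec_smul, map_neg, conjVec_conjVec, inner_conj_symm]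
  module

/-- The bracket preserves both `W` and `W^⊥`: the `z` and `z̄` terms only see the `W`-part of `w`,
the other four only its tangential part. -/
theorem act_lie_tauInvMat (hz : z ∈ liftedQuadric m) {u v : E m} (hu : u ∈ tangent z)
    (hv : v ∈ tangent z) (w : E m) :
    act ⁅tauInvMat z u, tauInvMat z v⁆ w =
      (inner ℂ z w * (inner ℂ v u - inner ℂ u v) : ℂ) • z
      + (inner ℂ (conjVec z) w * (inner ℂ u v - inner ℂ v u) : ℂ) • conjVec z
      - (inner ℂ v w : ℂ) • u - (inner ℂ (conjVec v) w : ℂ) • conjVec u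
      + (inner ℂ u w : ℂ) • v + (inner ℂ (conjVec u) w : ℂ) • conjVec v := by
  rw [Ring.lie_def, act_sub, act_mul_tauInvMat hz hu hv, act_mul_tauInvMat hz hv hu,
    inner_conjVec_comm v u]
  module

end Bracket

/-! ### Algebra of the conjugations `v ↦ μ v̄`. -/

section TangentConj

variable {m : ℕ} {z : E m} {μ : ℂ}

theorem tangentConj_tangentConj (hμ : ‖μ‖ = 1) (v : tangent z) :
    tangentConj z μ (tangentConj z μ v) = v := by
  refine Subtype.ext ?_
  rw [coe_tangentConj, coe_tangentConj, conjVec_smul, conjVec_conjVec, smul_smul, Complex.mul_conj,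
    Complex.normSq_eq_norm_sq, hμ]
  simp

theorem inner_tangentConj_tangentConj (hμ : ‖μ‖ = 1) (u v : tangent z) :
    inner ℂ (tangentConj z μ u) (tangentConj z μ v) = inner ℂ v u := by
  rw [Submodule.coe_inner, coe_tangentConj, coe_tangentConj, inner_smul_left, inner_smul_right,
    inner_conjVec_conjVec, ← mul_assoc, mul_comm _ μ, Complex.mul_conj,
    Complex.normSq_eq_norm_sq, hμ]
  simp

theorem inner_tangentConj_left (u v : tangent z) :
    inner ℂ (tangentConj z μ u) v
      = (starRingEnd ℂ) μ * inner ℂ (conjVec (u : E m)) (v : E m) := by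
  rw [Submodule.coe_inner, coe_tangentConj, inner_smul_left]

theorem inner_tangentConj_comm (u v : tangent z) :
    inner ℂ (tangentConj z μ u) v = inner ℂ (tangentConj z μ v) u := by
  rw [inner_tangentConj_left, inner_tangentConj_left, inner_conjVec_comm]

theorem tangentConj_smul (c : ℂ) (v : tangent z) :
    tangentConj z μ (c • v) = (starRingEnd ℂ) c • tangentConj z μ v := by
  refine Subtype.ext ?_
  rw [coe_tangentConj, Submodule.coe_smul, Submodule.coe_smul, conjVec_smul, coe_tangentConj,
    smul_comm]

end TangentConj

/-! ### Flat subspaces and Cartan subalgebras. -/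

section Flat

variable {m : ℕ} {z : liftedQuadric m} {μ : ℂ}

/-- The first condition is the vanishing of the bracket on `W`, where its coefficients at `z` and
`z̄` are opposite; the second is its vanishing on `W^⊥`. The conjugation enters twice in each term,
once conjugate linearly, so its phase `μ` cancels and may be chosen freely. -/
theorem lie_eq_zero_iff (hμ : ‖μ‖ = 1) (u v : tangent (z : E m)) :
    ⁅((tau z).symm u : Mat m), ((tau z).symm v : Mat m)⁆ = 0 ↔
      (inner ℂ u v = (inner ℂ v u : ℂ) ∧ ∀ w : tangent (z : E m),
        (inner ℂ v w : ℂ) • u + (inner ℂ (tangentConj _ μ v) w : ℂ) • tangentConj _ μ u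
          = (inner ℂ u w : ℂ) • v + (inner ℂ (tangentConj _ μ u) w : ℂ) • tangentConj _ μ v) := by
  have hμ' : μ * (starRingEnd ℂ) μ = 1 := by
    rw [Complex.mul_conj, Complex.normSq_eq_norm_sq, hμ]; simp
  have key : ∀ a b w : E m, (inner ℂ (μ • conjVec a) w : ℂ) • μ • conjVec b
      = (inner ℂ (conjVec a) w : ℂ) • conjVec b := fun a b w => by
    rw [inner_smul_left, smul_smul, mul_right_comm, mul_comm _ μ, hμ', one_mul]
  rw [tau_symm_eq, tau_symm_eq]
  obtain ⟨z, hz⟩ := z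
  obtain ⟨u, hu⟩ := u
  obtain ⟨v, hv⟩ := v
  have hu' := mem_tangent.1 hu
  have hv' := mem_tangent.1 hv
  simp only [Subtype.ext_iff, Submodule.coe_add, Submodule.coe_smul, Submodule.coe_inner,
    coe_tangentConj, key]
  constructor
  · intro h
    have h0 : ∀ w, act ⁅tauInvMat z u, tauInvMat z v⁆ w = 0 := fun w => by rw [h, act_zero]; rfl
    constructor
    · have h1 := h0 z
      rw [act_lie_tauInvMat hz hu hv] at h1
      have h2 := congrArg (fun x => (inner ℂ z x : ℂ)) h1
      have hcu := mem_tangent.1 (conjVec_mem_tangent hu)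
      have hcv := mem_tangent.1 (conjVec_mem_tangent hv)
      simp only [inner_add_right, inner_sub_right, inner_smul_right, hu'.1, hv'.1, hcu.1, hcv.1,
        inner_self_lifted hz, inner_self_conjVec hz, mul_zero, sub_zero, add_zero, mul_one, one_mul,
        inner_zero_right] at h2
      exact (sub_eq_zero.1 h2).symm
    · rintro ⟨w, hw⟩
      have h1 := h0 w
      rw [act_lie_tauInvMat hz hu hv, (mem_tangent.1 hw).1, (mem_tangent.1 hw).2] at h1
      rw [← sub_eq_zero, ← neg_eq_zero, ← h1]
      module
  · rintro ⟨h1, h2⟩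
    refine eq_zero_of_act_eq_zero fun w => ?_
    obtain ⟨a, ha, b, hb, rfl⟩ := (planeW z).exists_add_mem_mem_orthogonal w
    have h3 := h2 ⟨b, hb⟩
    have ha0 : ∀ x ∈ tangent z, inner ℂ x a = 0 := fun x hx =>
      inner_eq_zero_symm.1 (hx a ha)
    rw [act_lie_tauInvMat hz hu hv, h1]
    simp only [inner_add_right, ha0 _ hu, ha0 _ hv, ha0 _ (conjVec_mem_tangent hu),
      ha0 _ (conjVec_mem_tangent hv), zero_add, sub_self, mul_zero, zero_smul, zero_sub]
    rw [← sub_eq_zero] at h3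
    rw [← neg_eq_zero, ← h3]
    module

variable {F : Submodule ℝ (tangent (z : E m))}

theorem IsFlat.inner_comm (hF : IsFlat z F) {u v : tangent (z : E m)} (hu : u ∈ F) (hv : v ∈ F) :
    inner ℂ u v = (inner ℂ v u : ℂ) :=
  ((lie_eq_zero_iff (μ := 1) (by simp) u v).1 (hF u hu v hv)).1

theorem IsFlat.im_inner (hF : IsFlat z F) {u v : tangent (z : E m)} (hu : u ∈ F) (hv : v ∈ F) :
    (inner ℂ u v : ℂ).im = 0 := by
  have h := hF.inner_comm hu hv
  rw [← inner_conj_symm v u] at h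
  exact Complex.conj_eq_iff_im.1 h.symm

theorem IsFlat.smul_add_smul (hF : IsFlat z F) (hμ : ‖μ‖ = 1) {u v : tangent (z : E m)}
    (hu : u ∈ F) (hv : v ∈ F) (w : tangent (z : E m)) :
    (inner ℂ v w : ℂ) • u + (inner ℂ (tangentConj _ μ v) w : ℂ) • tangentConj _ μ u
      = (inner ℂ u w : ℂ) • v + (inner ℂ (tangentConj _ μ u) w : ℂ) • tangentConj _ μ v :=
  ((lie_eq_zero_iff hμ u v).1 (hF u hu v hv)).2 w

/-- On orthogonal vectors `v` of a flat subspace the ratio of `|⟨A v, v⟩|` and `‖v‖ ^ 2` is constant. -/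
theorem IsFlat.norm_inner_tangentConj (hF : IsFlat z F) (hμ : ‖μ‖ = 1)
    {u v : tangent (z : E m)} (hu : u ∈ F) (hv : v ∈ F) (h : inner ℂ u v = (0 : ℂ)) :
    ‖u‖ ^ 2 * ‖(inner ℂ (tangentConj _ μ v) v : ℂ)‖
      = ‖(inner ℂ (tangentConj _ μ u) u : ℂ)‖ * ‖v‖ ^ 2 := by
  -- Pairing the flatness identity at `w = u` with `A v` kills the left side and leaves `‖u‖² ⟨A v,
  -- v⟩ + ⟨A u, u⟩ ‖v‖² = 0`.
  have h1 := congrArg (fun x => (inner ℂ (tangentConj (z : E m) μ v) x : ℂ))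
    (hF.smul_add_smul hμ hu hv u)
  simp only [inner_add_right, inner_smul_right, inner_tangentConj_tangentConj hμ, h,
    inner_eq_zero_symm.1 h, zero_mul, mul_zero, add_zero] at h1
  have h2 := congrArg norm (eq_neg_of_add_eq_zero_left h1.symm)
  simpa [inner_self_eq_norm_sq_to_K] using h2

/-- Write `b(x, y) = ⟨x̄, y⟩`. The flatness identity for `d, a`, evaluated at `b` and paired with
`c`, has real Hermitian terms; its imaginary part allows `a` and `d` to be exchanged in `b(a, b) ·
conj b(c, d)`. -/
theorem IsFlat.im_mul_conj_swap (hF : IsFlat z F) {a b c d : tangent (z : E m)} (ha : a ∈ F)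
    (hb : b ∈ F) (hc : c ∈ F) (hd : d ∈ F) :
    ((inner ℂ (tangentConj (z : E m) 1 a) b : ℂ)
      * (starRingEnd ℂ) (inner ℂ (tangentConj (z : E m) 1 c) d : ℂ)).im
    = ((inner ℂ (tangentConj (z : E m) 1 d) b : ℂ)
      * (starRingEnd ℂ) (inner ℂ (tangentConj (z : E m) 1 c) a : ℂ)).im := by
  have h1 := congrArg (fun x => (inner ℂ c x : ℂ).im)
    (hF.smul_add_smul (μ := 1) (by simp) hd ha b)
  simp only [inner_add_right, inner_smul_right, Complex.add_im] at h1
  have e : ∀ x, (inner ℂ c (tangentConj (z : E m) 1 x) : ℂ)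
      = (starRingEnd ℂ) (inner ℂ (tangentConj (z : E m) 1 c) x : ℂ) := fun x => by
    rw [inner_tangentConj_comm, inner_conj_symm]
  rw [e, e, Complex.mul_im (inner ℂ a b), Complex.mul_im (inner ℂ d b), hF.im_inner ha hb,
    hF.im_inner hc hd, hF.im_inner hd hb, hF.im_inner hc ha] at h1
  simpa using h1

/-- Swaps together with the symmetry of the bilinear form interchange the two factors, whereas
conjugation shows that this interchange changes the sign of the imaginary part. Thus all values of
the form on `F` lie on one real line in `ℂ`. -/
theorem IsFlat.im_mul_conj (hF : IsFlat z F) {a b c d : tangent (z : E m)} (ha : a ∈ F)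
    (hb : b ∈ F) (hc : c ∈ F) (hd : d ∈ F) :
    ((inner ℂ (tangentConj (z : E m) 1 a) b : ℂ)
      * (starRingEnd ℂ) (inner ℂ (tangentConj (z : E m) 1 c) d : ℂ)).im = 0 := by
  have h : ((inner ℂ (tangentConj (z : E m) 1 a) b : ℂ)
      * (starRingEnd ℂ) (inner ℂ (tangentConj (z : E m) 1 c) d : ℂ)).im
    = ((inner ℂ (tangentConj (z : E m) 1 c) d : ℂ)
      * (starRingEnd ℂ) (inner ℂ (tangentConj (z : E m) 1 a) b : ℂ)).im := by
    rw [inner_tangentConj_comm c d, hF.im_mul_conj_swap ha hb hd hc, inner_tangentConj_comm c b,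
      inner_tangentConj_comm d a, hF.im_mul_conj_swap hb hc ha hd, inner_tangentConj_comm d c]
  simp only [Complex.mul_im, Complex.conj_re, Complex.conj_im] at h ⊢
  linarith

/-- A flat subspace is adapted to one of the conjugations. -/
theorem IsFlat.exists_im_eq_zero (hF : IsFlat z F) : ∃ μ : ℂ, ‖μ‖ = 1 ∧ ∀ u ∈ F, ∀ v ∈ F,
    (inner ℂ (tangentConj (z : E m) μ u) v : ℂ).im = 0 := by
  by_cases h : ∀ u ∈ F, ∀ v ∈ F, (inner ℂ (tangentConj (z : E m) 1 u) v : ℂ) = 0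
  · exact ⟨1, by simp, fun u hu v hv => by rw [h u hu v hv, Complex.zero_im]⟩
  · push Not at h
    obtain ⟨a, ha, b, hb, hab⟩ := h
    set β : ℂ := inner ℂ (tangentConj (z : E m) 1 a) b with hβ
    -- The phase of one nonzero value `β` rotates the common real line of all values onto `ℝ`.
    refine ⟨(‖β‖⁻¹ : ℝ) • β, ?_, fun u hu v hv => ?_⟩
    · rw [norm_smul, norm_inv, Real.norm_eq_abs, abs_norm, inv_mul_cancel₀ (norm_ne_zero_iff.2 hab)]
    · have h1 := hF.im_mul_conj hu hv ha hb
      have h2 : (inner ℂ (tangentConj (z : E m) ((‖β‖⁻¹ : ℝ) • β) u) v : ℂ)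
          = ((‖β‖⁻¹ : ℝ) : ℂ) * (inner ℂ (tangentConj (z : E m) 1 u) v
            * (starRingEnd ℂ) (inner ℂ (tangentConj (z : E m) 1 a) b)) := by
        rw [inner_tangentConj_left, inner_tangentConj_left, ← hβ, Complex.real_smul, map_mul,
          Complex.conj_ofReal, map_one]
        ring
      rw [h2, Complex.im_ofReal_mul, h1, mul_zero]

/-- The vector `w = u + ε A u` satisfies `⟨A a, w⟩ = ε ⟨a, w⟩` for `a ∈ F`, so the flatness identity
at `w` becomes `⟨v, w⟩ (u + ε A u) = ⟨u, w⟩ (v + ε A v)`. -/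
theorem IsFlat.smul_add_eq (hF : IsFlat z F) (hμ : ‖μ‖ = 1) (hr : ∀ u ∈ F, ∀ v ∈ F,
    (inner ℂ (tangentConj (z : E m) μ u) v : ℂ).im = 0) {ε : ℝ} (hε : ε ^ 2 = 1)
    {u v : tangent (z : E m)} (hu : u ∈ F) (hv : v ∈ F) :
    ((inner ℂ v u : ℂ).re + ε * (inner ℂ (tangentConj (z : E m) μ v) u : ℂ).re) •
        (u + ε • tangentConj (z : E m) μ u)
      = ((inner ℂ u u : ℂ).re + ε * (inner ℂ (tangentConj (z : E m) μ u) u : ℂ).re) •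
        (v + ε • tangentConj (z : E m) μ v) := by
  have e : ∀ {x : ℂ}, x.im = 0 → x = (x.re : ℂ) := fun h => Complex.ext rfl (by simp [h])
  have hs : ∀ (r : ℝ) (x : tangent (z : E m)), (r : ℂ) • x = r • x := fun r x => by
    rw [Complex.coe_smul]
  have hsw : ∀ a ∈ F, ∀ b ∈ F, (inner ℂ a (tangentConj (z : E m) μ b) : ℂ)
      = inner ℂ (tangentConj (z : E m) μ a) b := fun a ha b hb => by
    rw [← inner_conj_symm, Complex.conj_eq_iff_im.2 (hr b hb a ha), inner_tangentConj_comm]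
  have hw : ∀ a ∈ F, (inner ℂ a (u + ε • tangentConj (z : E m) μ u) : ℂ)
      = (((inner ℂ a u : ℂ).re + ε * (inner ℂ (tangentConj (z : E m) μ a) u : ℂ).re : ℝ) : ℂ) :=
    fun a ha => by
      rw [inner_add_right, ← hs, inner_smul_right, hsw a ha u hu, e (hF.im_inner ha hu),
        e (hr a ha u hu)]
      simp
  have hAw : ∀ a ∈ F, (inner ℂ (tangentConj (z : E m) μ a) (u + ε • tangentConj (z : E m) μ u) : ℂ)
      = (ε * ((inner ℂ a u : ℂ).re + ε * (inner ℂ (tangentConj (z : E m) μ a) u : ℂ).re) : ℝ) :=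
    fun a ha => by
      rw [inner_add_right, ← hs, inner_smul_right, inner_tangentConj_tangentConj hμ,
        hF.inner_comm hu ha, e (hF.im_inner ha hu), e (hr a ha u hu), mul_add, ← mul_assoc, ← sq,
        hε]
      push_cast [Complex.ofReal_re]
      ring
  have h := hF.smul_add_smul hμ hu hv (u + ε • tangentConj (z : E m) μ u)
  rw [hw v hv, hAw v hv, hw u hu, hAw u hu, hs, hs, hs, hs] at h
  calc _ = _ := by module
    _ = _ := h
    _ = _ := by module

/-- The parts `v ± A v` of the elements of a flat subspace all lie on one real line. -/
theorem IsFlat.exists_add_eq_smul (hF : IsFlat z F) (hμ : ‖μ‖ = 1) (hr : ∀ u ∈ F, ∀ v ∈ F,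
    (inner ℂ (tangentConj (z : E m) μ u) v : ℂ).im = 0) {ε : ℝ} (hε : ε ^ 2 = 1) :
    ∃ p : tangent (z : E m), ∀ v ∈ F, ∃ r : ℝ, v + ε • tangentConj (z : E m) μ v = r • p := by
  -- The tested coefficient is half of `‖u + ε A u‖²`. If it always vanishes, `p = 0` serves;
  -- otherwise any `u` with nonzero coefficient spans the line.
  by_cases h : ∀ u ∈ F, (inner ℂ u u : ℂ).re
      + ε * (inner ℂ (tangentConj (z : E m) μ u) u : ℂ).re = 0
  · refine ⟨0, fun v hv => ⟨0, ?_⟩⟩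
    rw [smul_zero, ← inner_self_eq_zero (𝕜 := ℂ)]
    have h1 := h v hv
    obtain ⟨a, e1⟩ : ∃ a : ℝ, (inner ℂ (tangentConj (z : E m) μ v) v : ℂ) = a :=
      ⟨_, Complex.ext rfl (by rw [hr v hv v hv, Complex.ofReal_im])⟩
    obtain ⟨b, e2⟩ : ∃ b : ℝ, (inner ℂ v v : ℂ) = b :=
      ⟨_, Complex.ext rfl (by rw [hF.im_inner hv hv, Complex.ofReal_im])⟩
    have e3 : (inner ℂ v (tangentConj (z : E m) μ v) : ℂ) = a := by
      rw [← inner_conj_symm, e1, Complex.conj_ofReal]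
    rw [e1, e2, Complex.ofReal_re, Complex.ofReal_re] at h1
    rw [← Complex.coe_smul, inner_add_left, inner_add_right, inner_add_right, inner_smul_left,
      inner_smul_left, inner_smul_right, inner_smul_right, inner_tangentConj_tangentConj hμ, e3,
      e1, e2, Complex.conj_ofReal]
    norm_cast
    linear_combination 2 * h1 + b * hε
  · push Not at h
    obtain ⟨u, hu, hne⟩ := h
    refine ⟨u + ε • tangentConj (z : E m) μ u, fun v hv =>
      ⟨((inner ℂ u u : ℂ).re + ε * (inner ℂ (tangentConj (z : E m) μ u) u : ℂ).re)⁻¹ *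
        ((inner ℂ v u : ℂ).re + ε * (inner ℂ (tangentConj (z : E m) μ v) u : ℂ).re), ?_⟩⟩
    rw [mul_smul, hF.smul_add_eq hμ hr hε hu hv, smul_smul, inv_mul_cancel₀ hne,
      one_smul]

theorem IsFlat.finrank_le_two (hF : IsFlat z F) : Module.finrank ℝ F ≤ 2 := by
  obtain ⟨μ, hμ, hr⟩ := hF.exists_im_eq_zero
  obtain ⟨p, hp⟩ := hF.exists_add_eq_smul hμ hr (ε := 1) (by norm_num)
  obtain ⟨q, hq⟩ := hF.exists_add_eq_smul hμ hr (ε := -1) (by norm_num)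
  -- Each `v` is half the sum of `v + A v` and `v - A v`.
  have hle : F ≤ Submodule.span ℝ {p, q} := fun v hv => by
    obtain ⟨r, hr⟩ := hp v hv
    obtain ⟨s, hs⟩ := hq v hv
    refine Submodule.mem_span_pair.2 ⟨r / 2, s / 2, ?_⟩
    rw [div_eq_inv_mul, div_eq_inv_mul, mul_smul, mul_smul, ← hr, ← hs]
    module
  classical
  calc Module.finrank ℝ F ≤ Module.finrank ℝ (Submodule.span ℝ {p, q}) :=
        Submodule.finrank_mono hle
    _ ≤ 2 := by
      have h := finrank_span_finset_le_card (R := ℝ) ({p, q} : Finset (tangent (z : E m)))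
      rw [Finset.coe_pair] at h
      exact h.trans Finset.card_le_two

theorem im_inner_eq_zero_of_fixed (hμ : ‖μ‖ = 1) {X Y : tangent (z : E m)}
    (hX : tangentConj _ μ X = X) (hY : tangentConj _ μ Y = Y) : (inner ℂ X Y : ℂ).im = 0 := by
  have h := inner_tangentConj_tangentConj hμ X Y
  rw [hX, hY, ← inner_conj_symm Y X] at h
  exact Complex.conj_eq_iff_im.1 h.symm

theorem inner_eq_zero_of_fixed (hμ : ‖μ‖ = 1) {X Y : tangent (z : E m)}
    (hX : tangentConj _ μ X = X) (hY : tangentConj _ μ Y = Y) (h : innerR X Y = 0) :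
    (inner ℂ X Y : ℂ) = 0 := by
  rw [← inner_conj_symm]
  have h2 := im_inner_eq_zero_of_fixed hμ hY hX
  have : (inner ℂ Y X : ℂ) = 0 := Complex.ext h h2
  rw [this, map_zero]

/-- Since `A X = X` and `A (J Y) = -J Y`, the two terms on each side of the flatness identity
cancel. -/
theorem isFlat_span (hμ : ‖μ‖ = 1) {X Y : tangent (z : E m)}
    (hX : tangentConj _ μ X = X) (hY : tangentConj _ μ Y = Y) (h : inner ℂ X Y = (0 : ℂ)) :
    IsFlat z (Submodule.span ℝ {X, I • Y}) := by
  have h0 : ⁅((tau z).symm X : Mat m), ((tau z).symm (I • Y) : Mat m)⁆ = 0 := by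
    rw [lie_eq_zero_iff hμ]
    constructor
    · rw [inner_smul_right, inner_smul_left, h, inner_eq_zero_symm.1 h]; simp
    · intro w
      rw [tangentConj_smul, hX, hY, inner_smul_left, inner_smul_left]
      simp only [Complex.conj_I, map_neg, neg_neg]
      module
  rw [Ring.lie_def, sub_eq_zero] at h0
  intro u hu v hv
  obtain ⟨a, b, rfl⟩ := Submodule.mem_span_pair.1 hu
  obtain ⟨c, d, rfl⟩ := Submodule.mem_span_pair.1 hv
  simp only [map_add, map_smul, Submodule.coe_add, Submodule.coe_smul, Ring.lie_def, mul_add,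
    add_mul, smul_mul_smul_comm, h0]
  module

theorem isCartan_span (hμ : ‖μ‖ = 1) {X Y : tangent (z : E m)}
    (hX : tangentConj _ μ X = X) (hY : tangentConj _ μ Y = Y) (hX1 : X ≠ 0) (hY1 : Y ≠ 0)
    (h : inner ℂ X Y = (0 : ℂ)) : IsCartan z (Submodule.span ℝ {X, I • Y}) := by
  refine ⟨isFlat_span hμ hX hY h, fun b hb => hb.finrank_le_two.trans ?_⟩
  have hli : LinearIndependent ℝ ![X, I • Y] := by
    rw [LinearIndependent.pair_iff]
    intro s t hst
    have e1 := congrArg (fun x => (inner ℂ X x : ℂ)) hst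
    have e2 := congrArg (fun x => (inner ℂ Y x : ℂ)) hst
    rw [← Complex.coe_smul, ← Complex.coe_smul] at e1 e2
    simp only [inner_add_right, inner_smul_right, h, inner_eq_zero_symm.1 h, mul_zero, add_zero,
      zero_add, inner_zero_right] at e1 e2
    simpa [hX1, hY1] using And.intro e1 e2
  have := finrank_span_eq_card hli
  rw [Matrix.range_cons, Matrix.range_cons, Matrix.range_empty, Set.union_empty,
    Set.singleton_union] at this
  simp [this]

end Flat
-- Invariance of the norm and of `quadNorm` under `Ad`.
section Adjoint

variable {m : ℕ}

/-- The modulus of `∑ v_k ^ 2`. -/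
noncomputable def quadNorm (v : E m) : ℝ := ‖(inner ℂ (conjVec v) v : ℂ)‖

theorem norm_inner_tangentConj_self {z : E m} {μ : ℂ} (hμ : ‖μ‖ = 1) (v : tangent z) :
    ‖(inner ℂ (tangentConj z μ v) v : ℂ)‖ = quadNorm (v : E m) := by
  rw [inner_tangentConj_left, norm_mul, RCLike.norm_conj, hμ, one_mul, quadNorm]

theorem norm_innerC (z : liftedQuadric m) (v : tangent (z : E m))
    {A : tangent (z : E m) →ₗ[ℝ] tangent (z : E m)} (hA : A ∈ cqStructure (z : E m)) :
    ‖innerC v (A v)‖ = quadNorm (v : E m) := by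
  obtain ⟨μ, hμ, rfl⟩ := (mem_cqStructure z.2).1 hA
  exact norm_inner_tangentConj_self hμ v

theorem quadNorm_smul (a : ℂ) (v : E m) : quadNorm (a • v) = ‖a‖ ^ 2 * quadNorm v := by
  rw [quadNorm, conjVec_smul, inner_smul_left, inner_smul_right, Complex.conj_conj, norm_mul,
    norm_mul, quadNorm]
  ring

theorem quadNorm_conjVec (v : E m) : quadNorm (conjVec v) = quadNorm v := by
  rw [quadNorm, inner_conjVec_conjVec, ← inner_conj_symm, RCLike.norm_conj, quadNorm]

theorem inner_act_act {g : Mat m} (hg : g.transpose * g = 1) (u w : E m) :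
    inner ℂ (act g u) (act g w) = (inner ℂ u w : ℂ) := by
  rw [inner_act, ← act_mul, hg, act_one]

theorem norm_act {g : Mat m} (hg : g.transpose * g = 1) (w : E m) : ‖act g w‖ = ‖w‖ := by
  rw [norm_eq_sqrt_re_inner (𝕜 := ℂ), inner_act_act hg, ← norm_eq_sqrt_re_inner]

theorem quadNorm_act {g : Mat m} (hg : g.transpose * g = 1) (w : E m) :
    quadNorm (act g w) = quadNorm w := by
  rw [quadNorm, ← act_conjVec, inner_act_act hg, quadNorm]

theorem coe_Ad (z : liftedQuadric m) (g : Mat m) (hg : g ∈ planeStabilizer (z : E m))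
    (v : tangent (z : E m)) :
    (Ad z g hg v : E m) = act g (act (tauInvMat (z : E m) v) (act g.transpose (z : E m))) := by
  rw [← tau_symm_eq, ← act_mul, ← act_mul]
  rfl

/-- `Ad g v` is `g v` or `g v̄` up to a phase. -/
theorem exists_coe_Ad_eq (z : liftedQuadric m) {g : Mat m} (hg : g ∈ planeStabilizer (z : E m))
    (v : tangent (z : E m)) : ∃ a : ℂ, ‖a‖ = 1 ∧
      ((Ad z g hg v : E m) = act g (a • (v : E m)) ∨
        (Ad z g hg v : E m) = act g (a • conjVec (v : E m))) := by
  obtain ⟨o1, o2⟩ := orth_of_mem hg.1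
  have o2' : g.transpose.transpose * g.transpose = 1 := by rwa [Matrix.transpose_transpose]
  have h1 : act g.transpose (z : E m) ∈ planeW (z : E m) := by
    have h2 := self_mem_planeW (z : E m)
    rw [← hg.2] at h2
    obtain ⟨y, hy, hyz⟩ := h2
    have h3 : act g.transpose (z : E m) = y := by rw [← hyz, ← act_mul, o1, act_one]
    rw [h3]; exact hy
  obtain ⟨a, b, hab⟩ := Submodule.mem_span_pair.1 h1
  have hAd : (Ad z g hg v : E m) = act g (a • (v : E m) + b • conjVec (v : E m)) := by
    rw [coe_Ad, ← hab, map_add, map_smul, map_smul, act_conjVec, act_tauInvMat_self z.2 v.2]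
  have hz := z.2
  have hn : ‖act g.transpose (z : E m)‖ = 1 := by rw [norm_act o2', hz.1]
  have hq : (inner ℂ (conjVec (act g.transpose (z : E m))) (act g.transpose (z : E m)) : ℂ) = 0 := by
    rw [← act_conjVec, inner_act_act o2', inner_conjVec_self hz]
  rw [← hab] at hn hq
  -- `gᵀ z = a z + b z̄` is again isotropic, and `∑ (a z + b z̄)_k ^ 2 = 2 a b`. So `gᵀ z` is a unit
  -- multiple of `z` or of `z̄`, and the real matrix of `v` sends these to multiples of `v` or `v̄`.
  have hab0 : a * b = 0 := by
    simp only [conjVec_add, conjVec_smul, conjVec_conjVec, inner_add_left, inner_add_right,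
      inner_smul_left, inner_smul_right, inner_self_lifted hz, inner_conjVec_self hz,
      inner_self_conjVec hz, inner_conjVec_conjVec_self hz, Complex.conj_conj] at hq
    linear_combination hq / 2
  rcases mul_eq_zero.1 hab0 with rfl | rfl
  · rw [zero_smul, zero_add, norm_smul, norm_conjVec, hz.1, mul_one] at hn
    exact ⟨b, hn, Or.inr (by rw [hAd, zero_smul, zero_add])⟩
  · rw [zero_smul, add_zero, norm_smul, hz.1, mul_one] at hn
    exact ⟨a, hn, Or.inl (by rw [hAd, zero_smul, add_zero])⟩

theorem norm_Ad (z : liftedQuadric m) {g : Mat m} (hg : g ∈ planeStabilizer (z : E m))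
    (v : tangent (z : E m)) : ‖Ad z g hg v‖ = ‖v‖ := by
  obtain ⟨a, ha, h | h⟩ := exists_coe_Ad_eq z hg v
  · rw [Submodule.coe_norm, h, norm_act (orth_of_mem hg.1).1, norm_smul, ha, one_mul,
      Submodule.coe_norm]
  · rw [Submodule.coe_norm, h, norm_act (orth_of_mem hg.1).1, norm_smul, ha, one_mul,
      norm_conjVec, Submodule.coe_norm]

theorem quadNorm_Ad (z : liftedQuadric m) {g : Mat m} (hg : g ∈ planeStabilizer (z : E m))
    (v : tangent (z : E m)) : quadNorm (Ad z g hg v : E m) = quadNorm (v : E m) := by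
  obtain ⟨a, ha, h | h⟩ := exists_coe_Ad_eq z hg v
  · rw [h, quadNorm_act (orth_of_mem hg.1).1, quadNorm_smul, ha, one_pow, one_mul]
  · rw [h, quadNorm_act (orth_of_mem hg.1).1, quadNorm_smul, ha, one_pow, one_mul,
      quadNorm_conjVec]

theorem one_mem_isotropyGroup (z : E m) : (1 : Mat m) ∈ isotropyGroup z := by
  refine ⟨one_mem _, ?_⟩
  have : act (1 : Mat m) = LinearMap.id := LinearMap.ext act_one
  rw [this, Submodule.map_id]

theorem Ad_one (z : liftedQuadric m) (h : (1 : Mat m) ∈ planeStabilizer (z : E m))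
    (v : tangent (z : E m)) : Ad z 1 h v = v := by
  refine Subtype.ext ?_
  rw [coe_Ad, Matrix.transpose_one, act_one, act_one, act_tauInvMat_self z.2 v.2]

end Adjoint

/-! ### Existence, uniqueness and invariance of the characteristic angle. -/

section Angle

variable {m : ℕ} {z : liftedQuadric m} {μ : ℂ}

theorem norm_sq_add_smul_I {X Y : tangent (z : E m)} (hX1 : ‖X‖ = 1) (hY1 : ‖Y‖ = 1)
    (h : inner ℂ X Y = (0 : ℂ)) (α β : ℝ) :
    ‖(α : ℂ) • X + (β : ℂ) • I • Y‖ ^ 2 = α ^ 2 + β ^ 2 := by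
  have h0 : inner ℂ ((α : ℂ) • X) ((β : ℂ) • I • Y) = (0 : ℂ) := by
    rw [inner_smul_left, inner_smul_right, inner_smul_right, h]; simp
  rw [sq, norm_add_sq_eq_norm_sq_add_norm_sq_of_inner_eq_zero _ _ h0]
  simp only [norm_smul, hX1, hY1, Complex.norm_real, Complex.norm_I, Real.norm_eq_abs, mul_one,
    abs_mul_abs_self]
  ring

theorem inner_tangentConj_add_smul_I {X Y : tangent (z : E m)}
    (hX : tangentConj _ μ X = X) (hY : tangentConj _ μ Y = Y) (hX1 : ‖X‖ = 1) (hY1 : ‖Y‖ = 1)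
    (h : inner ℂ X Y = (0 : ℂ)) (α β : ℝ) :
    (inner ℂ (tangentConj _ μ ((α : ℂ) • X + (β : ℂ) • I • Y)) ((α : ℂ) • X + (β : ℂ) • I • Y) : ℂ)
      = ((α ^ 2 - β ^ 2 : ℝ) : ℂ) := by
  have h1 : (inner ℂ X X : ℂ) = 1 := by rw [inner_self_eq_norm_sq_to_K, hX1]; simp
  have h2 : (inner ℂ Y Y : ℂ) = 1 := by rw [inner_self_eq_norm_sq_to_K, hY1]; simp
  rw [map_add, tangentConj_smul, tangentConj_smul, tangentConj_smul, hX, hY]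
  simp only [inner_add_left, inner_add_right, inner_smul_left, inner_smul_right, h, h1, h2,
    inner_eq_zero_symm.1 h, Complex.conj_ofReal, Complex.conj_I, map_neg, neg_neg]
  push_cast
  linear_combination (β : ℂ) ^ 2 * Complex.I_mul_I

theorem IsCharacteristicAngle.mem_Icc_and_eq {v : tangent (z : E m)} (hv : v ≠ 0) {ψ : ℝ}
    (h : IsCharacteristicAngle z v ψ) :
    ψ ∈ Set.Icc 0 (π / 4) ∧ quadNorm (v : E m) = Real.cos (2 * ψ) * ‖v‖ ^ 2 := by
  obtain ⟨a, -, -, A, hA, X, Y, hX, hY, hX1, hY1, hXY, -, g, hg, ⟨s, t, hs, ht, hst⟩, rfl⟩ := h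
  obtain ⟨μ, hμ, rfl⟩ := (mem_cqStructure z.2).1 hA
  have hXY' := inner_eq_zero_of_fixed hμ hX hY hXY
  set w := Ad z g (isotropyGroup_subset _ hg) v with hw
  have hwv : ‖w‖ = ‖v‖ := norm_Ad z _ v
  have hqw : quadNorm (w : E m) = quadNorm (v : E m) := quadNorm_Ad z _ v
  clear_value w
  -- In the coordinates of `X` and `J Y` the cone `s, t ≥ 0` reads `0 ≤ β ≤ α`.
  set α : ℝ := √2 * (s + t) with hα
  set β : ℝ := √2 * t with hβ
  have hwe : w = (α : ℂ) • X + (β : ℂ) • I • Y := by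
    rw [hst, Complex.coe_smul, Complex.coe_smul, hα, hβ]
    module
  have hβ0 : 0 ≤ β := by positivity
  have hαβ : β ≤ α := by
    rw [hα, hβ]
    exact mul_le_mul_of_nonneg_left (by linarith) (Real.sqrt_nonneg _)
  have hn : ‖w‖ ^ 2 = α ^ 2 + β ^ 2 := by rw [hwe, norm_sq_add_smul_I hX1 hY1 hXY']
  have hw0 : 0 < ‖w‖ := by rw [hwv]; exact norm_pos_iff.2 hv
  have hq : quadNorm (w : E m) = α ^ 2 - β ^ 2 := by
    rw [← norm_inner_tangentConj_self hμ, hwe,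
      inner_tangentConj_add_smul_I hX hY hX1 hY1 hXY', Complex.norm_real, Real.norm_eq_abs,
      abs_of_nonneg]
    nlinarith
  have hang : angleR (√2 • X) w = Real.arccos (α / ‖w‖) := by
    have h2 : innerR (√2 • X) w = √2 * α := by
      have h3 : (inner ℂ w (√2 • X) : ℂ) = ((√2 * α : ℝ) : ℂ) := by
        rw [hwe, ← Complex.coe_smul, inner_smul_right, inner_add_left, inner_smul_left,
          inner_smul_left, inner_smul_left, inner_eq_zero_symm.1 hXY', inner_self_eq_norm_sq_to_K,
          hX1]
        simp
      rw [innerR, innerC, h3, Complex.ofReal_re]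
    rw [angleR, h2, norm_smul, hX1, Real.norm_of_nonneg (Real.sqrt_nonneg _), mul_one,
      mul_div_mul_left _ _ (by positivity)]
  have hle : α / ‖w‖ ≤ 1 := by
    rw [div_le_one hw0]
    exact abs_le_of_sq_le_sq' (by nlinarith) hw0.le |>.2
  -- From `β ≤ α` follows `‖w‖² ≤ 2 α²`, which is the bound `π/4` on the angle.
  have hge : √2 / 2 ≤ α / ‖w‖ := by
    rw [le_div_iff₀ hw0]
    refine (abs_le_of_sq_le_sq' ?_ (hβ0.trans hαβ)).2
    rw [mul_pow, hn, div_pow, Real.sq_sqrt (by norm_num)]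
    nlinarith
  rw [hang]
  refine ⟨⟨Real.arccos_nonneg _, Real.arccos_le_pi_div_four.2 hge⟩, ?_⟩
  rw [Real.cos_two_mul, Real.cos_arccos (by linarith [Real.sqrt_nonneg 2]) hle, ← hqw, ← hwv, hq,
    div_pow, sub_mul, mul_assoc, div_mul_cancel₀ _ (by positivity), hn]
  ring

/-- As `m + 2 > 3`, some `y ≠ 0` is orthogonal to `z`, `z̄` and `X`. Then `y + A y` is fixed by `A`,
and if it vanishes, `i y` is fixed because `A` is antilinear. -/
theorem exists_fixed_orthogonal (hm : 2 ≤ m) (hμ : ‖μ‖ = 1) {X : tangent (z : E m)}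
    (hX : tangentConj _ μ X = X) :
    ∃ Y : tangent (z : E m), tangentConj _ μ Y = Y ∧ ‖Y‖ = 1 ∧ inner ℂ X Y = (0 : ℂ) := by
  obtain ⟨y, hy, hXy⟩ : ∃ y : tangent (z : E m), y ≠ 0 ∧ inner ℂ X y = (0 : ℂ) := by
    classical
    let S : Submodule ℂ (E m) := Submodule.span ℂ (({(z : E m), conjVec (z : E m), (X : E m)} :
      Finset (E m)) : Set (E m))
    have h1 : Module.finrank ℂ S ≤ 3 := (finrank_span_finset_le_card _).trans Finset.card_le_three
    have h2 := S.finrank_add_finrank_orthogonal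
    have h3 : Module.finrank ℂ (E m) = m + 2 := by simp
    have h4 : Sᗮ ≠ ⊥ := by
      intro h
      rw [h, finrank_bot] at h2
      omega
    obtain ⟨y, hy, hy0⟩ := Submodule.exists_mem_ne_zero_of_ne_bot h4
    have h5 : ∀ x ∈ ({(z : E m), conjVec (z : E m), (X : E m)} : Finset (E m)), inner ℂ x y = 0 :=
      fun x hx => hy x (Submodule.subset_span hx)
    refine ⟨⟨y, mem_tangent.2 ⟨h5 _ (by simp), h5 _ (by simp)⟩⟩, fun h => hy0 (congrArg Subtype.val h),
      h5 _ (by simp)⟩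
  suffices h : ∃ Y : tangent (z : E m), tangentConj _ μ Y = Y ∧ Y ≠ 0 ∧ inner ℂ X Y = (0 : ℂ) by
    obtain ⟨Y, h1, h2, h3⟩ := h
    refine ⟨(‖Y‖⁻¹ : ℝ) • Y, by rw [map_smul, h1], ?_, ?_⟩
    · rw [norm_smul, norm_inv, norm_norm, inv_mul_cancel₀ (norm_ne_zero_iff.2 h2)]
    · rw [← Complex.coe_smul, inner_smul_right, h3, mul_zero]
  have hXAy : inner ℂ X (tangentConj (z : E m) μ y) = (0 : ℂ) := by
    have := inner_tangentConj_tangentConj hμ X y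
    rwa [hX, inner_eq_zero_symm.1 hXy] at this
  by_cases h : y + tangentConj (z : E m) μ y = 0
  · refine ⟨I • y, ?_, smul_ne_zero Complex.I_ne_zero hy, by rw [inner_smul_right, hXy, mul_zero]⟩
    rw [tangentConj_smul, Complex.conj_I, ← neg_eq_of_add_eq_zero_right h, smul_neg, neg_smul,
      neg_neg]
  · refine ⟨_, ?_, h, by rw [inner_add_right, hXy, hXAy, add_zero]⟩
    rw [map_add, tangentConj_tangentConj hμ]
    exact add_comm _ _

theorem exists_isCharacteristicAngle (hm : 2 ≤ m) {v : tangent (z : E m)} (hv : v ≠ 0) :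
    ∃ ψ, IsCharacteristicAngle z v ψ := by
  -- Taking for `μ` the phase of `∑ v_k ^ 2` makes `⟨A v, v⟩` real and nonnegative; if the sum
  -- vanishes, any phase does.
  obtain ⟨μ, hμ, hr⟩ : ∃ μ : ℂ, ‖μ‖ = 1 ∧
      (inner ℂ (tangentConj (z : E m) μ v) v : ℂ) = (quadNorm (v : E m) : ℂ) := by
    simp only [inner_tangentConj_left, quadNorm]
    set b : ℂ := inner ℂ (conjVec (v : E m)) (v : E m)
    by_cases hb : b = 0
    · exact ⟨1, by simp, by simp [hb]⟩
    · have hb' : (‖b‖ : ℂ) ≠ 0 := by simpa using hb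
      refine ⟨b / ‖b‖, by simp [hb], ?_⟩
      rw [map_div₀, Complex.conj_ofReal, div_mul_eq_mul_div, mul_comm, Complex.mul_conj,
        Complex.normSq_eq_norm_sq, div_eq_iff hb']
      push_cast
      ring
  set A := tangentConj (z : E m) μ with hA
  have hAA := tangentConj_tangentConj (z := (z : E m)) hμ
  set P : tangent (z : E m) := (1 / 2 : ℂ) • (v + A v) with hP
  set R : tangent (z : E m) := (-I / 2 : ℂ) • (v - A v) with hR
  have hAP : A P = P := by
    rw [hP, hA, tangentConj_smul, map_add, hAA, map_div₀, map_one, map_ofNat]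
    module
  have hAR : A R = R := by
    rw [hR, hA, tangentConj_smul, map_sub, hAA, map_div₀, map_neg, Complex.conj_I, map_ofNat]
    module
  have hvPR : v = P + I • R := by
    rw [hP, hR, smul_smul]
    rw [show I * (-I / 2) = (1 / 2 : ℂ) by linear_combination (-1 / 2 : ℂ) * Complex.I_mul_I]
    module
  clear_value P R
  have hreal : (inner ℂ P R : ℂ) = ((inner ℂ P R : ℂ).re : ℂ) :=
    Complex.ext rfl (by rw [im_inner_eq_zero_of_fixed hμ hAP hAR, Complex.ofReal_im])
  have hsymm : (inner ℂ R P : ℂ) = inner ℂ P R := by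
    rw [← inner_conj_symm, hreal, Complex.conj_ofReal]
  -- The imaginary part of this identity gives `P ⊥ R`, the real part `‖R‖ ≤ ‖P‖`.
  have hval : (inner ℂ (A v) v : ℂ) = ((‖P‖ ^ 2 - ‖R‖ ^ 2 : ℝ) : ℂ) + 2 * (inner ℂ P R : ℂ) * I := by
    rw [hvPR, map_add, hA, tangentConj_smul, ← hA, hAP, hAR]
    simp only [inner_add_left, inner_add_right, inner_smul_left, inner_smul_right, hsymm,
      inner_self_eq_norm_sq_to_K, Complex.conj_I, map_neg, neg_neg]
    push_cast
    linear_combination (‖R‖ : ℂ) ^ 2 * Complex.I_mul_I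
  rw [hr, hreal] at hval
  obtain ⟨hre, him⟩ := Complex.ext_iff.1 hval
  simp only [Complex.add_re, Complex.add_im, Complex.mul_re, Complex.mul_im, Complex.ofReal_re,
    Complex.ofReal_im, Complex.I_re, Complex.I_im, Complex.re_ofNat, Complex.im_ofNat] at hre him
  have hPR : (inner ℂ P R : ℂ) = 0 := by
    rw [hreal, show (inner ℂ P R : ℂ).re = 0 by linarith, Complex.ofReal_zero]
  have hle : ‖R‖ ≤ ‖P‖ := by
    have h0 : 0 ≤ quadNorm (v : E m) := norm_nonneg _
    exact abs_le_of_sq_le_sq' (by linarith) (norm_nonneg _) |>.2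
  have hP0 : ‖P‖ ≠ 0 := fun h => hv (by
    rw [h] at hle
    rw [hvPR, norm_eq_zero.1 h, norm_le_zero_iff.1 hle, smul_zero, add_zero])
  set X : tangent (z : E m) := (‖P‖⁻¹ : ℝ) • P with hX
  have hAX : A X = X := by rw [hX, map_smul, hAP]
  have hX1 : ‖X‖ = 1 := by rw [hX, norm_smul, norm_inv, norm_norm, inv_mul_cancel₀ hP0]
  have hPX : P = ‖P‖ • X := by rw [hX, smul_smul, mul_inv_cancel₀ hP0, one_smul]
  obtain ⟨Y, hAY, hY1, hXY, hRY⟩ : ∃ Y : tangent (z : E m), A Y = Y ∧ ‖Y‖ = 1 ∧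
      inner ℂ X Y = (0 : ℂ) ∧ R = ‖R‖ • Y := by
    -- If `R = 0`, the vector `v` does not determine `Y`, and `m ≥ 2` provides one.
    by_cases hR0 : ‖R‖ = 0
    · obtain ⟨Y, h1, h2, h3⟩ := exists_fixed_orthogonal hm hμ hAX
      exact ⟨Y, h1, h2, h3, by rw [hR0, zero_smul, norm_eq_zero.1 hR0]⟩
    · refine ⟨(‖R‖⁻¹ : ℝ) • R, by rw [map_smul, hAR], ?_, ?_, ?_⟩
      · rw [norm_smul, norm_inv, norm_norm, inv_mul_cancel₀ hR0]
      · rw [hX, ← Complex.coe_smul, ← Complex.coe_smul, inner_smul_left, inner_smul_right, hPR]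
        simp
      · rw [smul_smul, mul_inv_cancel₀ hR0, one_smul]
  clear_value X
  have hvXY : v = ‖P‖ • X + ‖R‖ • I • Y := by
    rw [smul_comm ‖R‖ I Y, ← hRY, ← hPX, ← hvPR]
  have hne : ∀ {x : tangent (z : E m)}, ‖x‖ = 1 → x ≠ 0 := fun h h0 => by simp [h0] at h
  -- The vector already lies in the cone, so `g = 1`; the coefficients solve `√2 (s + t) = ‖P‖` and
  -- `√2 t = ‖R‖`.
  refine ⟨_, Submodule.span ℝ {X, I • Y}, isCartan_span hμ hAX hAY (hne hX1) (hne hY1) hXY,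
    Submodule.mem_span_pair.2 ⟨_, _, hvXY.symm⟩, A, tangentConj_mem_cqStructure z.2 hμ, X, Y, hAX,
    hAY, hX1, hY1, ?_, rfl, 1, one_mem_isotropyGroup _, ⟨(‖P‖ - ‖R‖) / √2, ‖R‖ / √2, ?_, ?_, ?_⟩,
    rfl⟩
  · rw [innerR, innerC, inner_eq_zero_symm.1 hXY, Complex.zero_re]
  · exact div_nonneg (sub_nonneg.2 hle) (Real.sqrt_nonneg _)
  · positivity
  · rw [Ad_one, smul_smul, smul_smul, div_mul_cancel₀ _ (by positivity),
      div_mul_cancel₀ _ (by positivity)]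
    refine hvXY.trans ?_
    module

theorem cos_two_mul_injOn : Set.InjOn (fun ψ : ℝ => Real.cos (2 * ψ)) (Set.Icc 0 (π / 4)) := by
  intro x hx y hy h
  have hx' : 2 * x ∈ Set.Icc 0 π := ⟨by linarith [hx.1], by linarith [hx.2, Real.pi_pos]⟩
  have hy' : 2 * y ∈ Set.Icc 0 π := ⟨by linarith [hy.1], by linarith [hy.2, Real.pi_pos]⟩
  linarith [Real.injOn_cos hx' hy' h]

theorem isCharacteristicAngle_charAngle (hm : 2 ≤ m) {v : tangent (z : E m)} (hv : v ≠ 0) :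
    IsCharacteristicAngle z v (charAngle z v) := by
  have h := exists_isCharacteristicAngle hm hv
  rw [charAngle, dif_pos h]
  exact h.choose_spec

theorem charAngle_eq_iff (hm : 2 ≤ m) {v : tangent (z : E m)} (hv : v ≠ 0) {ψ : ℝ}
    (hψ : ψ ∈ Set.Icc 0 (π / 4)) :
    ψ = charAngle z v ↔ quadNorm (v : E m) = Real.cos (2 * ψ) * ‖v‖ ^ 2 := by
  obtain ⟨h1, h2⟩ := (isCharacteristicAngle_charAngle hm hv).mem_Icc_and_eq hv
  refine ⟨fun h => h ▸ h2, fun h => cos_two_mul_injOn hψ h1 ?_⟩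
  have : ‖v‖ ^ 2 ≠ 0 := by simpa using hv
  exact mul_right_cancel₀ this (h.symm.trans h2)

theorem isCharacteristicAngle_iff (hm : 2 ≤ m) {v : tangent (z : E m)} (hv : v ≠ 0) {ψ : ℝ} :
    IsCharacteristicAngle z v ψ ↔ ψ = charAngle z v := by
  refine ⟨fun h => ?_, fun h => h ▸ isCharacteristicAngle_charAngle hm hv⟩
  obtain ⟨h1, h2⟩ := h.mem_Icc_and_eq hv
  exact (charAngle_eq_iff hm hv h1).2 h2

/-- The angle depends only on the ratio of `quadNorm v` to `‖v‖ ^ 2`; each of (b), (c), (d) is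
reduced to this. -/
theorem charAngle_congr (hm : 2 ≤ m) {u v : tangent (z : E m)} (hu : u ≠ 0) (hv : v ≠ 0)
    (h : ‖v‖ ^ 2 * quadNorm (u : E m) = quadNorm (v : E m) * ‖u‖ ^ 2) :
    charAngle z u = charAngle z v := by
  obtain ⟨h1, h2⟩ := (isCharacteristicAngle_charAngle hm hu).mem_Icc_and_eq hu
  rw [charAngle_eq_iff hm hv h1]
  have : ‖u‖ ^ 2 ≠ 0 := by simpa using hu
  refine mul_right_cancel₀ this ?_
  rw [← h, h2]
  ring

/-- With `A' = B A B⁻¹` one has `⟨B v, A' B v⟩ = ⟨B v, B A v⟩ = ⟨v, A v⟩`, and `quadNorm` can be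
computed with any member of the circle. -/
theorem IsCQAutomorphism.quadNorm_apply {B : tangent (z : E m) ≃ₗᵢ[ℂ] tangent (z : E m)}
    (hB : IsCQAutomorphism B) (v : tangent (z : E m)) :
    quadNorm (B v : E m) = quadNorm (v : E m) := by
  have hA := tangentConj_mem_cqStructure z.2 (μ := 1) (by simp)
  obtain ⟨A', hA', h⟩ := hB _ hA
  rw [← norm_innerC z _ hA', ← norm_innerC z _ hA, h, B.symm_apply_apply, innerC, innerC,
    B.inner_map_map]

end Angle
end ComplexQuadric

theorem proposition4p4 (m : ℕ) (hm : 2 ≤ m) (z : liftedQuadric m) (v : tangent (z : E m))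
    (hv : v ≠ 0) :
    -- the characteristic angle is well defined and lies in `[0, π/4]`
    ((∀ ψ : ℝ, IsCharacteristicAngle z v ψ ↔ ψ = charAngle z v) ∧
      charAngle z v ∈ Set.Icc 0 (π / 4)) ∧
    -- (a)
    ((∀ A ∈ cqStructure (z : E m), ∀ A' ∈ cqStructure (z : E m),
        ‖innerC v (A v)‖ = ‖innerC v (A' v)‖) ∧
      (∀ A ∈ cqStructure (z : E m), ‖innerC v (A v)‖ = Real.cos (2 * charAngle z v) * ‖v‖ ^ 2) ∧
      (∀ ψ ∈ Set.Icc 0 (π / 4), ψ = charAngle z v ↔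
        ∃ A ∈ cqStructure (z : E m), ‖innerC v (A v)‖ = Real.cos (2 * ψ) * ‖v‖ ^ 2)) ∧
    -- (b)
    (∀ c : ℝ, c ≠ 0 → charAngle z (c • v) = charAngle z v) ∧
    -- (c)
    ((∀ B : tangent (z : E m) ≃ₗᵢ[ℂ] tangent (z : E m), IsCQAutomorphism B →
        charAngle z (B v) = charAngle z v) ∧
      (∀ (g : Mat m) (hg : g ∈ isotropyGroup (z : E m)),
        charAngle z (Ad z g (isotropyGroup_subset _ hg) v) = charAngle z v) ∧
      (∀ (g : Mat m) (hg : g ∈ planeStabilizer (z : E m)),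
        charAngle z (Ad z g hg v) = charAngle z v)) ∧
    -- (d)
    (∀ (a : Submodule ℝ (tangent (z : E m))) (v' : tangent (z : E m)),
      IsCartan z a → v ∈ a → v' ∈ a → v' ≠ 0 → innerR v v' = 0 →
        charAngle z v' = charAngle z v) := by
  obtain ⟨hIcc, hcos⟩ := (isCharacteristicAngle_charAngle hm hv).mem_Icc_and_eq hv
  have hAd : ∀ (g : Mat m) (hg : g ∈ planeStabilizer (z : E m)),
      charAngle z (Ad z g hg v) = charAngle z v := fun g hg => by
    have h0 : Ad z g hg v ≠ 0 := by
      rw [← norm_ne_zero_iff, norm_Ad]; exact norm_ne_zero_iff.2 hv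
    exact charAngle_congr hm h0 hv (by rw [norm_Ad, quadNorm_Ad, mul_comm])
  refine ⟨⟨fun ψ => isCharacteristicAngle_iff hm hv, hIcc⟩, ⟨?_, ?_, ?_⟩, ?_,
    ⟨?_, fun g hg => hAd g _, hAd⟩, ?_⟩
  · intro A hA A' hA'
    rw [norm_innerC z v hA, norm_innerC z v hA']
  · intro A hA
    rw [norm_innerC z v hA, hcos]
  · intro ψ hψ
    rw [charAngle_eq_iff hm hv hψ]
    constructor
    · intro h
      have hA := tangentConj_mem_cqStructure z.2 (μ := 1) (by simp)
      exact ⟨_, hA, by rw [norm_innerC z v hA, h]⟩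
    · rintro ⟨A, hA, h⟩
      rw [← h, norm_innerC z v hA]
  · intro c hc
    refine charAngle_congr hm (smul_ne_zero hc hv) hv ?_
    rw [← Complex.coe_smul, norm_smul, Submodule.coe_smul, quadNorm_smul]
    ring
  · intro B hB
    refine charAngle_congr hm (by simpa using hv) hv ?_
    rw [hB.quadNorm_apply, B.norm_map, mul_comm]
  · intro a v' ha hva hva' hv' h
    refine charAngle_congr hm hv' hv ?_
    -- Hermitian products within a flat subspace are real, so real orthogonality is already complex
    -- orthogonality.
    have h0 : (inner ℂ v v' : ℂ) = 0 := by
      rw [ha.1.inner_comm hva hva']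
      exact Complex.ext h (ha.1.im_inner hva' hva)
    have h1 := ha.1.norm_inner_tangentConj (μ := 1) (by simp) hva hva' h0
    rwa [norm_inner_tangentConj_self (by simp), norm_inner_tangentConj_self (by simp)] at h1
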